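/- Theorem 4.1. Let $L^1(\mathbb Z)$ be the Banach algebra of absolutely summable functions $F:\mathbb Z\to\mathbb C$ with norm $\|F\|_1=\sum_{k}|F(k)|$, convolution product $(F*G)(m)=\sum_{k\in\mathbb Z}F(k)G(m-k)$ and unit $\delta_0$; write $F^{(n)}$ for the $n$-th convolution power, $e^{A}=\sum_{k\ge0}A^{(k)}/k!$ for the exponential in this algebra, and $L(F)$ for the operator $G\mapsto F*G$ on $L^1(\mathbb Z)$. Let $F$ be a probability on $\mathbb Z^+=\{0,1,2,\dots\}$, that is, $F\in L^1(\mathbb Z)$, $F\ge0$, $\sum_kF(k)=1$ and $F(k)=0$ for $k<0$. Put $\widehat F(\xi)=\sum_{k}F(k)e^{-ik\xi}$ for $\xi\in[-\pi,\pi]$ and $\varphi_F(w)=\sum_{k\ge0}F(k)w^k$ for $|w|\le1$. Let $\mathbb D$ be the open unit disc and, for $\theta\in(0,\pi/2)$, let $\overline\Lambda_\theta=\{0\}\cup\{z\in\mathbb C\setminus\{0\}:|\operatorname{Arg}z|\le\theta\}$. A bounded operator $T$ on a complex Banach space is power-bounded if $\sup_{n\ge1}\|T^n\|<\infty$, and Ritt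 if it is power-bounded and $\sup_{n\ge1}n\|T^n-T^{n+1}\|<\infty$; for $T$ power-bounded put $\Psi(F;T)=\sum_{k\ge0}F(k)T^k$. Let $\mathcal A$ be the set of probabilities $F$ on $\mathbb Z^+$ with $\sup_{n\ge1}n\|F^{(n)}-F^{(n+1)}\|_1<\infty$. The following conditions are equivalent: (I) $F\in\mathcal A$; (II) $L(F)$ is a Ritt operator on $L^1(\mathbb Z)$; (III) for every complex Banach space $X$ and every power-bounded bounded linear operator $T$ on $X$, the operator $\Psi(F;T)$ is a Ritt operator; (IV) $\widehat F(\xi)\in\mathbb D\cup\{1\}$ for all $\xi\in[-\pi,\pi]$, and $\sup_{t\ge1}t\,\|(\delta_0-F)*e^{-t(\delta_0-F)}\|_1<\infty$. Moreover, if $F\in\mathcal A$, then there is a $\theta\in(0,\pi/2)$ such that $\varphi_F(w)\in\mathbb D\cup\{1\}$ and $1-\varphi_F(w)\in\overline\Lambda_\theta$ for all $w$ with $|w|\le1$. Finally, if $F\in\mathcal A$ and $F\ne\delta_0$, then $\sum_{k\ge0}kF(k)=+\infty$, and hence $\{k:F(k)\ne0\}$ is infinite. -/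

import Mathlib

open scoped ENNReal ComplexOrder

noncomputable section

namespace RittProb

/-- The Banach space `L¹(ℤ)` of absolutely summable functions `ℤ → ℂ`, with its usual norm.
Below it is made into a Banach algebra under convolution. -/
abbrev L1Z : Type := lp (fun _ : ℤ => ℂ) 1

namespace L1Z

lemma summable_norm (F : L1Z) : Summable fun k : ℤ => ‖F k‖ := by
  have h := (lp.memℓp F).summable (by simp)
  simpa using h

lemma norm_eq (F : L1Z) : ‖F‖ = ∑' k : ℤ, ‖F k‖ := by
  have h := lp.norm_eq_tsum_rpow (p := 1) (by simp) F
  simpa using h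

lemma memlp_of_summable {f : ℤ → ℂ} (hf : Summable fun k => ‖f k‖) :
    Memℓp (E := fun _ : ℤ => ℂ) f 1 :=
  memℓp_gen (by simpa using hf)

/-- The shear `(m, k) ↦ (k, m - k)` of `ℤ × ℤ`. -/
def shear : ℤ × ℤ ≃ ℤ × ℤ where
  toFun p := (p.2, p.1 - p.2)
  invFun q := (q.1 + q.2, q.1)
  left_inv p := by ext <;> simp
  right_inv q := by ext <;> simp

lemma summable_double {f g : ℤ → ℂ} (hf : Summable fun k => ‖f k‖)
    (hg : Summable fun k => ‖g k‖) :
    Summable fun p : ℤ × ℤ => ‖f p.2 * g (p.1 - p.2)‖ := by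
  have h := hf.mul_of_nonneg hg (fun _ => norm_nonneg _) (fun _ => norm_nonneg _)
  have h2 := (shear.summable_iff).2 h
  refine h2.congr ?_
  intro p
  simp [shear]

lemma summable_term (F G : L1Z) (m : ℤ) : Summable fun k : ℤ => ‖F k * G (m - k)‖ :=
  (summable_double F.summable_norm G.summable_norm).prod_factor m

lemma summable_conv (F G : L1Z) : Summable fun m : ℤ => ‖∑' k : ℤ, F k * G (m - k)‖ := by
  refine Summable.of_nonneg_of_le (fun _ => norm_nonneg _) (fun m => ?_)
    (summable_double F.summable_norm G.summable_norm).prod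
  exact norm_tsum_le_tsum_norm (summable_term F G m)

/-- Convolution: `(F * G)(m) = ∑_{k ∈ ℤ} F(k) G(m - k)`. -/
instance : Mul L1Z where
  mul F G := ⟨fun m : ℤ => ∑' k : ℤ, F k * G (m - k), memlp_of_summable (summable_conv F G)⟩

/-- The unit element `δ₀`. -/
instance : One L1Z where
  one := lp.single 1 (0 : ℤ) (1 : ℂ)

lemma mul_apply (F G : L1Z) (m : ℤ) : (F * G) m = ∑' k : ℤ, F k * G (m - k) := rfl

lemma one_apply (m : ℤ) : (1 : L1Z) m = if m = 0 then 1 else 0 := by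
  change (lp.single 1 (0 : ℤ) (1 : ℂ) : L1Z) m = _
  rw [lp.single_apply]
  by_cases h : m = 0
  · subst h; simp
  · simp [h]

lemma conv_comm (F G : L1Z) : F * G = G * F := by
  ext m
  rw [mul_apply, mul_apply, ← (Equiv.subLeft m).tsum_eq]
  refine tsum_congr fun k => ?_
  simp [mul_comm]

lemma conv_add (F G H : L1Z) : F * (G + H) = F * G + F * H := by
  ext m
  change _ = (F * G) m + (F * H) m
  rw [mul_apply, mul_apply, mul_apply,
    ← (summable_term F G m).of_norm.tsum_add (summable_term F H m).of_norm]
  refine tsum_congr fun k => ?_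
  change F k * (G (m - k) + H (m - k)) = _
  ring

lemma conv_smul (c : ℂ) (F G : L1Z) : F * (c • G) = c • (F * G) := by
  ext m
  change _ = c * (F * G) m
  rw [mul_apply, mul_apply, ← tsum_mul_left]
  refine tsum_congr fun k => ?_
  change F k * (c * G (m - k)) = _
  ring

lemma one_conv (F : L1Z) : 1 * F = F := by
  ext m
  rw [mul_apply, tsum_eq_single 0]
  · simp [one_apply]
  · intro k hk
    simp [one_apply, hk]

lemma conv_assoc (F G H : L1Z) : F * G * H = F * (G * H) := by
  ext m
  have hsum : Summable fun p : ℤ × ℤ => F p.2 * G (p.1 - p.2) * H (m - p.1) := by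
    refine Summable.of_norm ?_
    refine Summable.of_nonneg_of_le (fun _ => norm_nonneg _) (fun p => ?_)
      ((summable_double F.summable_norm G.summable_norm).mul_right ‖H‖)
    rw [norm_mul]
    exact mul_le_mul_of_nonneg_left (lp.norm_apply_le_norm (by simp) H _) (norm_nonneg _)
  calc (F * G * H) m
      = ∑' k : ℤ, ∑' j : ℤ, F j * G (k - j) * H (m - k) := by
        rw [mul_apply]
        refine tsum_congr fun k => ?_
        rw [mul_apply, tsum_mul_right]
    _ = ∑' j : ℤ, ∑' k : ℤ, F j * G (k - j) * H (m - k) := Summable.tsum_comm hsum.prod_symm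
    _ = (F * (G * H)) m := by
        rw [mul_apply]
        refine tsum_congr fun j => ?_
        rw [mul_apply, ← tsum_mul_left, ← (Equiv.addLeft j).tsum_eq]
        refine tsum_congr fun k => ?_
        simp only [Equiv.coe_addLeft, add_sub_cancel_left, mul_assoc, sub_sub]

lemma norm_conv_le (F G : L1Z) : ‖F * G‖ ≤ ‖F‖ * ‖G‖ := by
  have h := summable_double F.summable_norm G.summable_norm
  calc ‖F * G‖ = ∑' m : ℤ, ‖∑' k : ℤ, F k * G (m - k)‖ := norm_eq _
    _ ≤ ∑' m : ℤ, ∑' k : ℤ, ‖F k * G (m - k)‖ :=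
        (summable_conv F G).tsum_le_tsum
          (fun m => norm_tsum_le_tsum_norm (summable_term F G m)) h.prod
    _ = ∑' p : ℤ × ℤ, ‖F p.2 * G (p.1 - p.2)‖ := (h.tsum_prod).symm
    _ = ∑' q : ℤ × ℤ, ‖F q.1‖ * ‖G q.2‖ := by
        rw [← shear.tsum_eq (fun q : ℤ × ℤ => ‖F q.1‖ * ‖G q.2‖)]
        refine tsum_congr fun p => ?_
        simp [shear]
    _ = ‖F‖ * ‖G‖ := by
        rw [norm_eq F, norm_eq G]
        exact (F.summable_norm.tsum_mul_tsum G.summable_norm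
          (F.summable_norm.mul_of_nonneg G.summable_norm (fun _ => norm_nonneg _)
            (fun _ => norm_nonneg _))).symm

/-- `L¹(ℤ)` is a commutative normed ring under convolution, for its usual norm. -/
instance : NormedCommRing L1Z where
  __ := (inferInstance : NormedAddCommGroup L1Z)
  mul_assoc := conv_assoc
  one_mul := one_conv
  mul_one F := by rw [conv_comm, one_conv]
  mul_comm := conv_comm
  left_distrib := conv_add
  right_distrib F G H := by rw [conv_comm, conv_add, conv_comm H F, conv_comm H G]
  zero_mul F := by
    rw [conv_comm]
    simpa using conv_smul 0 F 0
  mul_zero F := by simpa using conv_smul 0 F 0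
  norm_mul_le := norm_conv_le

/-- `L¹(ℤ)` is a normed algebra over `ℂ`, for its usual vector space structure. -/
instance : NormedAlgebra ℂ L1Z where
  __ := Algebra.ofModule (R := ℂ) (A := L1Z)
    (fun c F G => by rw [mul_comm, conv_smul, mul_comm]) (fun c F G => conv_smul c F G)
  norm_smul_le c F := norm_smul_le c F

end L1Z

/-- The convolution operator `L(F)` on `L¹(ℤ)`: `L(F) G = F * G`. -/
def convOp (F : L1Z) : L1Z →L[ℂ] L1Z := ContinuousLinearMap.mul ℂ L1Z F

/-- The probabilities on `ℤ⁺ = {0, 1, 2, …}`, as elements of `L¹(ℤ)`: the nonnegative (in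
particular real-valued) functions of total mass `1` supported in `ℤ⁺`. -/
def probZPlus : Set L1Z :=
  {F | (∀ k : ℤ, 0 ≤ F k) ∧ ∑' k : ℤ, F k = 1 ∧ Function.support (F : ℤ → ℂ) ⊆ {k | 0 ≤ k}}

/-- `A` is power-bounded: `sup_{n ≥ 1} ‖A ^ n‖ < ∞`. -/
def IsPowerBounded {B : Type*} [NormedRing B] (A : B) : Prop :=
  ∃ C : ℝ, ∀ n : ℕ, 1 ≤ n → ‖A ^ n‖ ≤ C

/-- A bounded operator `S` is a Ritt operator if it is power-bounded and
`sup_{n ≥ 1} n ‖S ^ n - S ^ (n + 1)‖ < ∞`. -/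
def IsRitt {X : Type*} [NormedAddCommGroup X] [NormedSpace ℂ X] (S : X →L[ℂ] X) : Prop :=
  IsPowerBounded S ∧ ∃ C : ℝ, ∀ n : ℕ, 1 ≤ n → n * ‖S ^ n - S ^ (n + 1)‖ ≤ C

/-- The class `𝒜` of probabilities `F` on `ℤ⁺` with
`sup_{n ≥ 1} n ‖F ^ n - F ^ (n + 1)‖₁ < ∞`, the powers being convolution powers. -/
def classA : Set L1Z :=
  {F | F ∈ probZPlus ∧ ∃ C : ℝ, ∀ n : ℕ, 1 ≤ n → n * ‖F ^ n - F ^ (n + 1)‖ ≤ C}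

/-- `Ψ(F; T) = ∑_{k ≥ 0} F(k) T ^ k`, used for `T` power-bounded, where the series converges
absolutely in operator norm. -/
def Psi (F : L1Z) {X : Type*} [NormedAddCommGroup X] [NormedSpace ℂ X] (T : X →L[ℂ] X) :
    X →L[ℂ] X :=
  ∑' k : ℕ, F (k : ℤ) • T ^ k

/-- The Fourier transform `F̂(ξ) = ∑_{k ∈ ℤ} F(k) e^{-ikξ}`. -/
def fourierZ (F : L1Z) (ξ : ℝ) : ℂ :=
  ∑' k : ℤ, F k * Complex.exp (-Complex.I * k * ξ)

/-- The generating function `φ_F(w) = ∑_{k ≥ 0} F(k) w ^ k`, used for `|w| ≤ 1`. -/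
def genFun (F : L1Z) (w : ℂ) : ℂ := ∑' k : ℕ, F (k : ℤ) * w ^ k

/-- `𝔻 ∪ {1}`: the open unit disc together with the point `1`. -/
def discOne : Set ℂ := Metric.ball 0 1 ∪ {1}

/-- The closed sector `{0} ∪ {z : |Arg z| ≤ θ}`. -/
def closedSector (θ : ℝ) : Set ℂ := {0} ∪ {z | |z.arg| ≤ θ}

end RittProb

end

/-!
All estimates take place in a Banach algebra `A` with an element `a` of bounded powers. The
semigroup `e^{-t(1-a)}` is the mean of `a ^ N` for a Poisson variable `N` of mean `t`, so a Ritt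
bound on `a` makes the semigroup analytic. Conversely, an analytic semigroup extends boundedly to a
sector by its exponential series, and its Laplace transform along rays tilted off the real axis
gives `‖(1 - za)⁻¹‖ ≤ K / |1 - z|` near the point `1` of the unit disc; away from `1` this follows
by compactness once `1 - za` is invertible for `|z| = 1`, `z ≠ 1`. For `a = F` this is
the condition on `F̂`, as the characters of `L¹(ℤ)` are the points of the circle. The Ritt bound
is then Cauchy's estimate on `|z| = n / (n + 1)` for
`(1 - a) (1 - za)⁻³ = ∑ binom(n + 2, 2) (a ^ n - a ^ (n + 1)) z ^ n`: the exponent `3` makes the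
coefficients quadratic in `n`, while the mean of `|1 - z|⁻²` over the circle is linear in `n`.

The operators `Ψ(F; T)` and the values `φ_F(w)` are images of `F` under the functional calculus
`F ↦ ∑ F(k) b ^ k` of `L¹(ℤ⁺)`, which preserves Ritt bounds, and for `T` the convolution by `δ₁` it
returns `L(F)`. On scalars an analytic bound confines `1 - φ_F(w)` to a sector. If the first moment
were finite, `t ↦ 1 - φ_F(e^{it})` would leave the vertex of that sector in an imaginary direction.
-/

noncomputable section

namespace RittProb

/-- The quantitative form of `sup_{n ≥ 1} n ‖a ^ n - a ^ (n + 1)‖ < ∞`. -/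
def HasRittBound {A : Type*} [NormedRing A] (a : A) (C : ℝ) : Prop :=
  ∀ n : ℕ, 1 ≤ n → n * ‖a ^ n - a ^ (n + 1)‖ ≤ C

/-- The semigroup `e^{-tb}` is analytic with constant `C`: `t ‖b e^{-tb}‖ ≤ C` for all `t ≥ 0`. -/
def HasAnalyticBound {A : Type*} [NormedRing A] [NormedAlgebra ℂ A] (b : A) (C : ℝ) : Prop :=
  ∀ t : ℝ, 0 ≤ t → t * ‖b * NormedSpace.exp (-(t : ℂ) • b)‖ ≤ C

/-- Ritt's resolvent condition on the open disc, `‖(1 - z a)⁻¹‖ ≤ K / |1 - z|`. -/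
def HasRittResolvent {A : Type*} [NormedRing A] [NormedAlgebra ℂ A] (a : A) (K : ℝ) : Prop :=
  ∀ z : ℂ, ‖z‖ < 1 → IsUnit (1 - z • a) ∧ ‖Ring.inverse (1 - z • a)‖ ≤ K / ‖1 - z‖

section Semigroup

variable {A : Type*} [NormedRing A] [NormedAlgebra ℂ A]

lemma IsPowerBounded.exists_forall_norm_pow_le {B : Type*} [NormedRing B] {a : B}
    (ha : IsPowerBounded a) : ∃ M : ℝ, ∀ n : ℕ, ‖a ^ n‖ ≤ M := by
  obtain ⟨C, hC⟩ := ha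
  refine ⟨max C ‖(1 : B)‖, fun n => ?_⟩
  rcases Nat.eq_zero_or_pos n with rfl | hn
  · rw [pow_zero]
    exact le_max_right _ _
  · exact (hC n hn).trans (le_max_left _ _)

lemma HasRittBound.nonneg {B : Type*} [NormedRing B] {a : B} {C : ℝ} (h : HasRittBound a C) :
    0 ≤ C :=
  le_trans (by positivity) (h 1 le_rfl)

lemma HasAnalyticBound.nonneg {b : A} {C : ℝ} (h : HasAnalyticBound b C) : 0 ≤ C :=
  le_trans (by positivity) (h 1 zero_le_one)

lemma commute_exp_smul (b : A) (s : ℂ) : Commute b (NormedSpace.exp (s • b)) := by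
  let _ := NormedAlgebra.restrictScalars ℚ ℂ A
  exact ((Commute.refl b).smul_right s).exp_right

variable [CompleteSpace A]

lemma exp_add_smul (b : A) (s t : ℂ) :
    NormedSpace.exp ((s + t) • b) = NormedSpace.exp (s • b) * NormedSpace.exp (t • b) := by
  let _ := NormedAlgebra.restrictScalars ℚ ℂ A
  rw [add_smul, NormedSpace.exp_add_of_commute (((Commute.refl b).smul_left s).smul_right t)]

lemma exp_smul_pow (b : A) (s : ℂ) (n : ℕ) :
    NormedSpace.exp (s • b) ^ n = NormedSpace.exp ((n * s) • b) := by
  let _ := NormedAlgebra.restrictScalars ℚ ℂ A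
  rw [mul_smul, Nat.cast_smul_eq_nsmul, NormedSpace.exp_nsmul]

lemma exp_algebraMap_add (z : ℂ) (b : A) :
    NormedSpace.exp (algebraMap ℂ A z + b) = Complex.exp z • NormedSpace.exp b := by
  let _ := NormedAlgebra.restrictScalars ℚ ℂ A
  rw [NormedSpace.exp_add_of_commute (Algebra.commutes z b), ← NormedSpace.algebraMap_exp_comm,
    ← Complex.exp_eq_exp_ℂ, ← Algebra.smul_def]

/-- The weights of the Poisson distribution of mean `t`. -/
def poissonWeight (t : ℝ) (k : ℕ) : ℝ := Real.exp (-t) * (t ^ k / k.factorial)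

lemma poissonWeight_nonneg {t : ℝ} (ht : 0 ≤ t) (k : ℕ) : 0 ≤ poissonWeight t k := by
  unfold poissonWeight
  positivity

lemma norm_ofReal_poissonWeight {t : ℝ} (ht : 0 ≤ t) (k : ℕ) :
    ‖(poissonWeight t k : ℂ)‖ = poissonWeight t k :=
  Complex.norm_of_nonneg (poissonWeight_nonneg ht k)

lemma hasSum_poissonWeight (t : ℝ) : HasSum (poissonWeight t) 1 := by
  have h := (NormedSpace.expSeries_div_hasSum_exp t).mul_left (Real.exp (-t))
  rwa [← Real.exp_eq_exp_ℝ, ← Real.exp_add, neg_add_cancel, Real.exp_zero] at h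

lemma mul_poissonWeight (t : ℝ) (k : ℕ) :
    t * poissonWeight t k = poissonWeight t (k + 1) * (k + 1) := by
  rw [poissonWeight, poissonWeight, Nat.factorial_succ, pow_succ]
  push_cast
  field_simp

lemma hasSum_poissonWeight_smul_pow (a : A) (t : ℝ) :
    HasSum (fun k : ℕ => (poissonWeight t k : ℂ) • a ^ k)
      (NormedSpace.exp (-(t : ℂ) • (1 - a))) := by
  have hexp : NormedSpace.exp (-(t : ℂ) • (1 - a)) =
      Complex.exp (-t) • NormedSpace.exp ((t : ℂ) • a) := by
    rw [← exp_algebraMap_add, Algebra.algebraMap_eq_smul_one, smul_sub, neg_smul, neg_smul,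
      sub_neg_eq_add]
  rw [hexp]
  convert! (NormedSpace.exp_series_hasSum_exp' (𝕂 := ℂ) ((t : ℂ) • a)).const_smul
    (Complex.exp (-t)) using 2 with k
  rw [smul_pow, smul_smul, smul_smul, poissonWeight]
  push_cast
  ring_nf

lemma norm_exp_neg_smul_one_sub_le {a : A} {M : ℝ} (hM : ∀ n : ℕ, ‖a ^ n‖ ≤ M) {t : ℝ}
    (ht : 0 ≤ t) : ‖NormedSpace.exp (-(t : ℂ) • (1 - a))‖ ≤ M := by
  rw [← (hasSum_poissonWeight_smul_pow a t).tsum_eq, ← one_mul M]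
  refine tsum_of_norm_bounded ((hasSum_poissonWeight t).mul_right M) fun k => ?_
  rw [norm_smul, norm_ofReal_poissonWeight ht]
  exact mul_le_mul_of_nonneg_left (hM k) (poissonWeight_nonneg ht k)

lemma hasAnalyticBound_of_succ_mul_norm_le {a : A} {D : ℝ}
    (hD : ∀ k : ℕ, (k + 1) * ‖(1 - a) * a ^ k‖ ≤ D) : HasAnalyticBound (1 - a) D := by
  intro t ht
  have hD0 : 0 ≤ D := le_trans (by positivity) (hD 0)
  have hterm : ∀ k : ℕ, ‖(t : ℂ) • ((1 - a) * ((poissonWeight t k : ℂ) • a ^ k))‖ ≤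
      poissonWeight t (k + 1) * D := by
    intro k
    rw [mul_smul_comm, norm_smul, norm_smul, Complex.norm_of_nonneg ht,
      norm_ofReal_poissonWeight ht, ← mul_assoc, mul_poissonWeight, mul_assoc]
    exact mul_le_mul_of_nonneg_left (hD k) (poissonWeight_nonneg ht _)
  have hshift := ((hasSum_nat_add_iff' 1).2 (hasSum_poissonWeight t)).mul_right D
  have hexp := ((hasSum_poissonWeight_smul_pow a t).mul_left (1 - a)).const_smul (t : ℂ)
  calc t * ‖(1 - a) * NormedSpace.exp (-(t : ℂ) • (1 - a))‖
      = ‖(t : ℂ) • ((1 - a) * NormedSpace.exp (-(t : ℂ) • (1 - a)))‖ := by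
        rw [norm_smul, Complex.norm_of_nonneg ht]
    _ = ‖∑' k : ℕ, (t : ℂ) • ((1 - a) * ((poissonWeight t k : ℂ) • a ^ k))‖ := by
        rw [hexp.tsum_eq]
    _ ≤ (1 - ∑ k ∈ Finset.range 1, poissonWeight t k) * D := tsum_of_norm_bounded hshift hterm
    _ ≤ D := by
        refine mul_le_of_le_one_left hD0 (sub_le_self _ ?_)
        exact Finset.sum_nonneg fun k _ => poissonWeight_nonneg ht k

lemma HasRittBound.hasAnalyticBound {a : A} {C : ℝ} (h : HasRittBound a C) :
    HasAnalyticBound (1 - a) (2 * C + ‖1 - a‖) := by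
  refine hasAnalyticBound_of_succ_mul_norm_le fun k => ?_
  rcases Nat.eq_zero_or_pos k with rfl | hk
  · simpa using h.nonneg
  · have hk1 : (1 : ℝ) ≤ k := by exact_mod_cast hk
    have hnorm := norm_nonneg (a ^ k - a ^ (k + 1))
    rw [sub_mul, one_mul, ← pow_succ']
    nlinarith [h k hk, norm_nonneg (1 - a)]

lemma exists_hasAnalyticBound_of_one_le {b : A} {C : ℝ}
    (h : ∀ t : ℝ, 1 ≤ t → t * ‖b * NormedSpace.exp (-(t : ℂ) • b)‖ ≤ C) :
    ∃ C' : ℝ, HasAnalyticBound b C' := by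
  let _ := NormedAlgebra.restrictScalars ℚ ℂ A
  have hcont : Continuous fun t : ℝ => t * ‖b * NormedSpace.exp (-(t : ℂ) • b)‖ := by
    have := NormedSpace.exp_continuous (𝔸 := A)
    fun_prop
  obtain ⟨D, hD⟩ := (isCompact_Icc (a := (0 : ℝ)) (b := 1)).bddAbove_image hcont.continuousOn
  refine ⟨max C D, fun t ht => ?_⟩
  rcases le_total 1 t with h1 | h1
  · exact (h t h1).trans (le_max_left _ _)
  · exact (hD ⟨t, ⟨ht, h1⟩, rfl⟩).trans (le_max_right _ _)

lemma HasAnalyticBound.pow_mul_norm_le {b : A} {C : ℝ} (h : HasAnalyticBound b C) {t : ℝ}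
    (ht : 0 ≤ t) {n : ℕ} (hn : 0 < n) :
    t ^ n * ‖b ^ n * NormedSpace.exp (-(t : ℂ) • b)‖ ≤ (C * n) ^ n := by
  have hpow : b ^ n * NormedSpace.exp (-(t : ℂ) • b) =
      (b * NormedSpace.exp (-((t / n : ℝ) : ℂ) • b)) ^ n := by
    rw [(commute_exp_smul b _).mul_pow, exp_smul_pow]
    congr 3
    push_cast
    field_simp
  calc t ^ n * ‖b ^ n * NormedSpace.exp (-(t : ℂ) • b)‖
      ≤ t ^ n * ‖b * NormedSpace.exp (-((t / n : ℝ) : ℂ) • b)‖ ^ n := by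
        rw [hpow]
        gcongr
        exact norm_pow_le' _ hn
    _ = (t / n * ‖b * NormedSpace.exp (-((t / n : ℝ) : ℂ) • b)‖ * n) ^ n := by
        rw [← mul_pow]
        field_simp
    _ ≤ (C * n) ^ n := by
        gcongr
        exact h (t / n) (by positivity)

lemma HasAnalyticBound.norm_smul_pow_mul_exp_le {b : A} {C κ : ℝ} (h : HasAnalyticBound b C)
    (hκ0 : 0 ≤ κ) (hκ : κ * (C * Real.exp 1) ≤ 1 / 2) {s t : ℝ} (ht : 0 ≤ t) (hs : |s| ≤ κ * t)
    {n : ℕ} (hn : 0 < n) :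
    ‖(n.factorial : ℂ)⁻¹ • (-(s * Complex.I) • b) ^ n * NormedSpace.exp (-(t : ℂ) • b)‖ ≤
      (1 / 2) ^ n := by
  have hC := h.nonneg
  have hfac : (n : ℝ) ^ n / n.factorial ≤ Real.exp 1 ^ n := by
    rw [← Real.exp_nat_mul, mul_one]
    exact Real.pow_div_factorial_le_exp (n : ℝ) n.cast_nonneg n
  have hnorm : ‖(n.factorial : ℂ)⁻¹ • (-(s * Complex.I) • b) ^ n *
      NormedSpace.exp (-(t : ℂ) • b)‖ =
      |s| ^ n * ‖b ^ n * NormedSpace.exp (-(t : ℂ) • b)‖ / n.factorial := by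
    rw [smul_pow, smul_smul, smul_mul_assoc, norm_smul, norm_mul, norm_inv, Complex.norm_natCast,
      norm_pow, norm_neg, norm_mul, Complex.norm_I, Complex.norm_real, Real.norm_eq_abs]
    ring
  rw [hnorm]
  calc |s| ^ n * ‖b ^ n * NormedSpace.exp (-(t : ℂ) • b)‖ / n.factorial
      ≤ (κ * t) ^ n * ‖b ^ n * NormedSpace.exp (-(t : ℂ) • b)‖ / n.factorial := by gcongr
    _ = κ ^ n * (t ^ n * ‖b ^ n * NormedSpace.exp (-(t : ℂ) • b)‖) / n.factorial := by ring
    _ ≤ κ ^ n * (C * n) ^ n / n.factorial := by gcongr; exact h.pow_mul_norm_le ht hn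
    _ = (κ * C) ^ n * ((n : ℝ) ^ n / n.factorial) := by ring
    _ ≤ (κ * C) ^ n * Real.exp 1 ^ n := by gcongr
    _ = (κ * (C * Real.exp 1)) ^ n := by ring
    _ ≤ (1 / 2) ^ n := by gcongr

lemma HasAnalyticBound.norm_exp_rotated_le {b : A} {C κ M : ℝ} (h : HasAnalyticBound b C)
    (hκ0 : 0 ≤ κ) (hκ : κ * (C * Real.exp 1) ≤ 1 / 2) (hM1 : 1 ≤ M)
    (hM : ∀ t : ℝ, 0 ≤ t → ‖NormedSpace.exp (-(t : ℂ) • b)‖ ≤ M) {s t : ℝ} (ht : 0 ≤ t)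
    (hs : |s| ≤ κ * t) : ‖NormedSpace.exp (-(t + s * Complex.I) • b)‖ ≤ 2 * M := by
  have hseries := (NormedSpace.exp_series_hasSum_exp' (𝕂 := ℂ) (-(s * Complex.I) • b)).mul_right
    (NormedSpace.exp (-(t : ℂ) • b))
  rw [neg_add_rev, exp_add_smul, ← hseries.tsum_eq]
  refine tsum_of_norm_bounded (hasSum_geometric_two.mul_right M) fun n => ?_
  rcases Nat.eq_zero_or_pos n with rfl | hn
  · simpa using hM t ht
  · exact (h.norm_smul_pow_mul_exp_le hκ0 hκ ht hs hn).trans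
      (le_mul_of_one_le_right (by positivity) hM1)

end Semigroup

section Resolvent

lemma norm_one_sub_pos_of_norm_lt_one {z : ℂ} (hz : ‖z‖ < 1) : 0 < ‖1 - z‖ := by
  rw [norm_pos_iff, sub_ne_zero]
  rintro rfl
  simp at hz

variable {A : Type*} [NormedRing A] [NormedAlgebra ℂ A]

lemma HasRittResolvent.nonneg {a : A} {K : ℝ} (h : HasRittResolvent a K) : 0 ≤ K := by
  have h0 := (norm_nonneg _).trans (h 0 (by simp)).2
  simpa using h0

variable [CompleteSpace A]

open MeasureTheory Filter Topology in
/-- The Laplace transform of the semigroup: `-S = ∫₀^∞ e^{td} dt`. -/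
lemma norm_le_div_of_norm_exp_le {d S : A} {M ω : ℝ} (hω : 0 < ω)
    (hd : ∀ t : ℝ, 0 ≤ t → ‖NormedSpace.exp ((t : ℂ) • d)‖ ≤ M * Real.exp (-ω * t))
    (hS : d * S = 1) : ‖S‖ ≤ M / ω := by
  have hderiv : ∀ t : ℝ, HasDerivAt (fun u : ℝ => NormedSpace.exp ((u : ℂ) • d) * S)
      (NormedSpace.exp ((t : ℂ) • d)) t := by
    intro t
    have h := (hasDerivAt_exp_smul_const (𝕂 := ℝ) d t).mul_const S
    rw [mul_assoc, hS, mul_one] at h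
    simpa only [Complex.coe_smul] using h
  have hexp_int : IntegrableOn (fun t : ℝ => M * Real.exp (-ω * t)) (Set.Ioi 0) :=
    (integrableOn_exp_mul_Ioi (neg_lt_zero.2 hω) 0).const_mul M
  have hbound : ∀ᵐ t : ℝ ∂volume.restrict (Set.Ioi (0 : ℝ)),
      ‖NormedSpace.exp ((t : ℂ) • d)‖ ≤ M * Real.exp (-ω * t) :=
    (ae_restrict_mem measurableSet_Ioi).mono fun t ht => hd t (Set.mem_Ioi.1 ht).le
  have hcont : Continuous fun t : ℝ => NormedSpace.exp ((t : ℂ) • d) := by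
    let _ := NormedAlgebra.restrictScalars ℚ ℂ A
    have := NormedSpace.exp_continuous (𝔸 := A)
    fun_prop
  have htendsto : Tendsto (fun t : ℝ => NormedSpace.exp ((t : ℂ) • d) * S) atTop (𝓝 0) := by
    have hdecay : Tendsto (fun t : ℝ => M * Real.exp (-ω * t) * ‖S‖) atTop (𝓝 0) := by
      have h := Real.tendsto_exp_atBot.comp (tendsto_id.const_mul_atTop_of_neg (neg_lt_zero.2 hω))
      simpa using (h.const_mul M).mul_const ‖S‖
    refine squeeze_zero_norm' ((eventually_ge_atTop 0).mono fun t ht => ?_) hdecay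
    exact (norm_mul_le _ _).trans (mul_le_mul_of_nonneg_right (hd t ht) (norm_nonneg S))
  have hlaplace := integral_Ioi_of_hasDerivAt_of_tendsto' (fun t _ => hderiv t)
    (hexp_int.mono' hcont.aestronglyMeasurable hbound) htendsto
  calc ‖S‖ = ‖∫ t in Set.Ioi (0 : ℝ), NormedSpace.exp ((t : ℂ) • d)‖ := by
        rw [hlaplace]
        simp
    _ ≤ ∫ t in Set.Ioi (0 : ℝ), M * Real.exp (-ω * t) :=
        norm_integral_le_of_norm_le hexp_int hbound
    _ = M / ω := by
        rw [integral_const_mul, integral_exp_mul_Ioi (neg_lt_zero.2 hω)]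
        rw [mul_zero, Real.exp_zero, neg_div_neg_eq, mul_one_div]

lemma norm_le_of_norm_exp_ray_le {b S : A} {c l : ℂ} {M : ℝ}
    (hM : ∀ t : ℝ, 0 ≤ t → ‖NormedSpace.exp (-(t * c) • b)‖ ≤ M) (hcl : 0 < (c * l).re)
    (hS : (algebraMap ℂ A l + b) * S = 1) : ‖S‖ ≤ ‖c‖ * M / (c * l).re := by
  have hc : c ≠ 0 := by
    rintro rfl
    simp at hcl
  have hdecay : ∀ t : ℝ, 0 ≤ t → ‖NormedSpace.exp ((t : ℂ) • (-c • (algebraMap ℂ A l + b)))‖ ≤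
      M * Real.exp (-(c * l).re * t) := by
    intro t ht
    have hsplit : (t : ℂ) • (-c • (algebraMap ℂ A l + b)) =
        algebraMap ℂ A (-(c * l) * t) + -(t * c) • b := by
      simp only [Algebra.algebraMap_eq_smul_one]
      module
    rw [hsplit, exp_algebraMap_add, norm_smul, Complex.norm_exp, Complex.re_mul_ofReal,
      Complex.neg_re, mul_comm]
    exact mul_le_mul_of_nonneg_right (hM t ht) (Real.exp_nonneg _)
  have hinv : -c • (algebraMap ℂ A l + b) * (-c⁻¹ • S) = 1 := by
    rw [smul_mul_smul_comm, hS, neg_mul_neg, mul_inv_cancel₀ hc, one_smul]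
  have h := norm_le_div_of_norm_exp_le hcl hdecay hinv
  rw [norm_smul, norm_neg, norm_inv, inv_mul_le_iff₀ (norm_pos_iff.2 hc)] at h
  rwa [mul_div_assoc]

/-- Integrating along whichever of the rays `ℝ⁺(1 ± iκ)` makes `Re(cl)` larger covers a sector of
opening larger than `π`. -/
lemma norm_le_of_norm_exp_sector_le {b S : A} {l : ℂ} {κ M : ℝ} (hκ0 : 0 < κ) (hκ1 : κ ≤ 1)
    (hM : ∀ s t : ℝ, 0 ≤ t → |s| ≤ κ * t → ‖NormedSpace.exp (-(t + s * Complex.I) • b)‖ ≤ M)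
    (hl0 : l ≠ 0) (hl : κ / 2 * ‖l‖ ≤ l.re + κ * |l.im|)
    (hS : (algebraMap ℂ A l + b) * S = 1) : ‖S‖ ≤ 4 * M / (κ * ‖l‖) := by
  have hM0 : 0 ≤ M := (norm_nonneg _).trans (hM 0 0 le_rfl (by simp))
  obtain ⟨σ, hσ, hσl⟩ : ∃ σ : ℝ, |σ| = κ ∧ -(σ * l.im) = κ * |l.im| := by
    rcases le_total 0 l.im with him | him
    · exact ⟨-κ, by rw [abs_neg, abs_of_pos hκ0], by rw [abs_of_nonneg him, neg_mul, neg_neg]⟩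
    · exact ⟨κ, abs_of_pos hκ0, by rw [abs_of_nonpos him, mul_neg]⟩
  have hc : ‖1 + σ * Complex.I‖ ≤ 2 := by
    refine (norm_add_le _ _).trans ?_
    rw [norm_one, norm_mul, Complex.norm_I, Complex.norm_real, Real.norm_eq_abs, hσ]
    linarith
  have hre : κ / 2 * ‖l‖ ≤ ((1 + σ * Complex.I) * l).re := by
    have : ((1 + σ * Complex.I) * l).re = l.re + κ * |l.im| := by
      rw [← hσl]
      simp [sub_eq_add_neg]
    rwa [this]
  have hray : ∀ t : ℝ, 0 ≤ t → ‖NormedSpace.exp (-(t * (1 + σ * Complex.I)) • b)‖ ≤ M := by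
    intro t ht
    have h := hM (t * σ) t ht (by rw [abs_mul, abs_of_nonneg ht, hσ, mul_comm])
    rwa [Complex.ofReal_mul, mul_assoc, ← mul_one_add] at h
  calc ‖S‖ ≤ ‖1 + σ * Complex.I‖ * M / ((1 + σ * Complex.I) * l).re :=
        norm_le_of_norm_exp_ray_le hray (lt_of_lt_of_le (by positivity) hre) hS
    _ ≤ 2 * M / (κ / 2 * ‖l‖) := by gcongr
    _ = 4 * M / (κ * ‖l‖) := by
        field_simp
        ring

lemma mem_sector_of_one_lt_norm_one_add {l : ℂ} {κ : ℝ} (hκ0 : 0 ≤ κ) (hκ1 : κ ≤ 1)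
    (h1 : 1 < ‖1 + l‖) (hl : ‖l‖ ≤ κ / 2) : κ / 2 * ‖l‖ ≤ l.re + κ * |l.im| := by
  have hre : 0 < 2 * l.re + ‖l‖ ^ 2 := by
    have hsq : 1 < ‖1 + l‖ ^ 2 := one_lt_pow₀ h1 two_ne_zero
    rw [← Complex.normSq_eq_norm_sq] at hsq ⊢
    rw [Complex.normSq_add, map_one, one_mul, Complex.conj_re] at hsq
    linarith
  have hnorm := Complex.norm_le_abs_re_add_abs_im l
  rcases abs_cases l.re with ⟨habs, hsign⟩ | ⟨habs, hsign⟩ <;> rw [habs] at hnorm <;>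
    nlinarith [norm_nonneg l, abs_nonneg l.im]

/-- Near `1` the map `z ↦ (1 - z) / z` sends the unit disc into a sector of opening slightly larger
than `π`. -/
lemma one_sub_div_mem_sector {z : ℂ} {κ : ℝ} (hκ1 : κ ≤ 1) (hz : ‖z‖ < 1)
    (hz1 : ‖1 - z‖ < κ / 4) : 1 / 2 ≤ ‖z‖ ∧ ‖1 - z‖ ≤ ‖(1 - z) / z‖ ∧
      κ / 2 * ‖(1 - z) / z‖ ≤ ((1 - z) / z).re + κ * |((1 - z) / z).im| := by
  have hhalf : 1 / 2 ≤ ‖z‖ := by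
    have h := norm_sub_norm_le 1 z
    rw [norm_one] at h
    linarith
  have hz0 : 0 < ‖z‖ := by linarith
  have hne : z ≠ 0 := norm_pos_iff.1 hz0
  have hκ0 : 0 < κ := by linarith [norm_nonneg (1 - z)]
  refine ⟨hhalf, ?_, mem_sector_of_one_lt_norm_one_add hκ0.le hκ1 ?_ ?_⟩
  · rw [norm_div]
    exact le_div_self (norm_nonneg _) hz0 hz.le
  · have hinv : 1 + (1 - z) / z = z⁻¹ := by field_simp; ring
    rw [hinv, norm_inv]
    exact (one_lt_inv₀ hz0).2 hz
  · rw [norm_div, div_le_iff₀ hz0]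
    nlinarith

lemma differentiableAt_inverse_one_sub_smul {a : A} {z : ℂ} (hz : IsUnit (1 - z • a)) :
    DifferentiableAt ℂ (fun w : ℂ => Ring.inverse (1 - w • a)) z :=
  DifferentiableAt.comp (f := fun w : ℂ => 1 - w • a) z (differentiableAt_inverse hz) (by fun_prop)

lemma exists_norm_inverse_one_sub_smul_le_of_far {a : A} {ε : ℝ} (hε : 0 < ε)
    (hunit : ∀ z : ℂ, ‖z‖ ≤ 1 → z ≠ 1 → IsUnit (1 - z • a)) :
    ∃ K : ℝ, ∀ z : ℂ, ‖z‖ ≤ 1 → ε ≤ ‖1 - z‖ → ‖Ring.inverse (1 - z • a)‖ ≤ K / ‖1 - z‖ := by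
  have hne : ∀ z : ℂ, ε ≤ ‖1 - z‖ → z ≠ 1 := by
    rintro _ hz rfl
    rw [sub_self, norm_zero] at hz
    exact hε.not_ge hz
  have hcompact : IsCompact (Metric.closedBall (0 : ℂ) 1 ∩ {z | ε ≤ ‖1 - z‖}) :=
    (isCompact_closedBall 0 1).inter_right (isClosed_le continuous_const (by fun_prop))
  obtain ⟨K, hK⟩ := hcompact.exists_bound_of_continuousOn
    (f := fun z => (1 - z) • Ring.inverse (1 - z • a)) fun z hz =>
      ContinuousAt.continuousWithinAt <| ContinuousAt.smul (by fun_prop)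
        (differentiableAt_inverse_one_sub_smul
          (hunit z (mem_closedBall_zero_iff.1 hz.1) (hne z hz.2))).continuousAt
  refine ⟨K, fun z hz hfar => ?_⟩
  rw [le_div_iff₀' (hε.trans_le hfar), ← norm_smul]
  exact hK z ⟨mem_closedBall_zero_iff.2 hz, hfar⟩

lemma isUnit_one_sub_smul_of_norm_lt_one {a : A} {M : ℝ} (hM : ∀ n : ℕ, ‖a ^ n‖ ≤ M) {z : ℂ}
    (hz : ‖z‖ < 1) : IsUnit (1 - z • a) := by
  have hsum : Summable fun n : ℕ => (z • a) ^ n := by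
    refine Summable.of_norm_bounded ((summable_geometric_of_lt_one (norm_nonneg z) hz).mul_right M)
      fun n => ?_
    rw [smul_pow, norm_smul, norm_pow]
    exact mul_le_mul_of_nonneg_left (hM n) (by positivity)
  exact isUnit_iff_exists.2 ⟨_, hsum.one_sub_mul_tsum_pow, hsum.tsum_pow_mul_one_sub⟩

lemma norm_inverse_one_sub_smul_le_of_near_one {a : A} {κ M : ℝ} (hκ1 : κ ≤ 1)
    (hM : ∀ s t : ℝ, 0 ≤ t → |s| ≤ κ * t →
      ‖NormedSpace.exp (-(t + s * Complex.I) • (1 - a))‖ ≤ M) {z : ℂ} (hz : ‖z‖ < 1)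
    (hz1 : ‖1 - z‖ < κ / 4) (hunit : IsUnit (1 - z • a)) :
    ‖Ring.inverse (1 - z • a)‖ ≤ 8 * M / κ / ‖1 - z‖ := by
  obtain ⟨hhalf, hle, hsector⟩ := one_sub_div_mem_sector hκ1 hz hz1
  have hκ0 : 0 < κ := by linarith [norm_nonneg (1 - z)]
  have hz0 : z ≠ 0 := norm_pos_iff.1 (by linarith)
  have h1z : 0 < ‖1 - z‖ := norm_one_sub_pos_of_norm_lt_one hz
  have hM0 : 0 ≤ M := (norm_nonneg _).trans (hM 0 0 le_rfl (by simp))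
  have hinv : (algebraMap ℂ A ((1 - z) / z) + (1 - a)) * (z • Ring.inverse (1 - z • a)) = 1 := by
    have hfactor : algebraMap ℂ A ((1 - z) / z) + (1 - a) = z⁻¹ • (1 - z • a) := by
      rw [sub_div, one_div, div_self hz0, map_sub, map_one, Algebra.algebraMap_eq_smul_one,
        smul_sub, smul_smul, inv_mul_cancel₀ hz0, one_smul]
      abel
    rw [hfactor, smul_mul_smul_comm, Ring.mul_inverse_cancel _ hunit, inv_mul_cancel₀ hz0, one_smul]
  have hres := norm_le_of_norm_exp_sector_le hκ0 hκ1 hM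
    (norm_pos_iff.1 (h1z.trans_le hle)) hsector hinv
  calc ‖Ring.inverse (1 - z • a)‖ ≤ 2 * ‖z • Ring.inverse (1 - z • a)‖ := by
        rw [norm_smul]
        nlinarith [norm_nonneg (Ring.inverse (1 - z • a))]
    _ ≤ 2 * (4 * M / (κ * ‖1 - z‖)) := by
        gcongr
        exact hres.trans (by gcongr)
    _ = 8 * M / κ / ‖1 - z‖ := by
        field_simp
        ring

theorem exists_hasRittResolvent {a : A} {C : ℝ} (ha : IsPowerBounded a)
    (hunit : ∀ z : ℂ, ‖z‖ = 1 → z ≠ 1 → IsUnit (1 - z • a)) (hC : HasAnalyticBound (1 - a) C) :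
    ∃ K : ℝ, HasRittResolvent a K := by
  obtain ⟨M, hM⟩ := ha.exists_forall_norm_pow_le
  have hC0 := hC.nonneg
  obtain ⟨κ, hκ0, hκ1, hκC⟩ : ∃ κ : ℝ, 0 < κ ∧ κ ≤ 1 ∧ κ * (C * Real.exp 1) ≤ 1 / 2 := by
    have hCe : 0 ≤ C * Real.exp 1 := by positivity
    refine ⟨1 / (2 * (C * Real.exp 1 + 1)), by positivity, ?_, ?_⟩
    · rw [div_le_one (by positivity)]
      linarith
    · field_simp
      linarith
  have hrotated : ∀ s t : ℝ, 0 ≤ t → |s| ≤ κ * t →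
      ‖NormedSpace.exp (-(t + s * Complex.I) • (1 - a))‖ ≤ 2 * max M 1 := fun s t ht hs =>
    hC.norm_exp_rotated_le hκ0.le hκC (le_max_right M 1)
      (fun u hu => (norm_exp_neg_smul_one_sub_le hM hu).trans (le_max_left M 1)) ht hs
  have hdisc : ∀ z : ℂ, ‖z‖ < 1 → IsUnit (1 - z • a) := fun z =>
    isUnit_one_sub_smul_of_norm_lt_one hM
  obtain ⟨K, hK⟩ := exists_norm_inverse_one_sub_smul_le_of_far (a := a) (ε := κ / 4)
    (by positivity) fun z hz => hz.lt_or_eq.elim (fun hlt _ => hdisc z hlt) (hunit z)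
  refine ⟨max K (8 * (2 * max M 1) / κ), fun z hz => ⟨hdisc z hz, ?_⟩⟩
  rcases le_or_gt (κ / 4) ‖1 - z‖ with hfar | hnear
  · refine (hK z hz.le hfar).trans ?_
    gcongr
    exact le_max_left _ _
  · refine (norm_inverse_one_sub_smul_le_of_near_one hκ1 hrotated hz hnear (hdisc z hz)).trans ?_
    gcongr
    exact le_max_right _ _

end Resolvent

/-- On `|z| = r` the integrand is a multiple of the Poisson kernel of the point `r²`. -/
lemma circleAverage_inv_norm_one_sub_sq {r : ℝ} (hr0 : 0 < r) (hr1 : r < 1) :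
    Real.circleAverage (fun z : ℂ => (‖1 - z‖ ^ 2)⁻¹) 0 r = (1 - r ^ 2)⁻¹ := by
  have hsub : ∀ z : ℂ, ‖z‖ = r → ‖z - r ^ 2‖ = r * ‖1 - z‖ := by
    intro z hz
    have hz2 : (r : ℂ) ^ 2 = z * starRingEnd ℂ z := by rw [Complex.mul_conj', hz]
    have hfactor : z - r ^ 2 = z * starRingEnd ℂ (1 - z) := by
      rw [hz2, map_sub, map_one, mul_one_sub]
    rw [hfactor, norm_mul, Complex.norm_conj, hz]
  have hkernel : Set.EqOn (fun z : ℂ => (‖1 - z‖ ^ 2)⁻¹)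
      (fun z => (1 - r ^ 2)⁻¹ • (poissonKernel 0 (r ^ 2 : ℂ) • fun _ => (1 : ℝ)) z)
      (Metric.sphere 0 |r|) := by
    intro z hz
    rw [mem_sphere_zero_iff_norm, abs_of_pos hr0] at hz
    have h1 : 1 - r ^ 2 ≠ 0 := by nlinarith
    have hnorm : ‖(r : ℂ) ^ 2‖ = r ^ 2 := by
      rw [norm_pow, Complex.norm_of_nonneg hr0.le]
    simp only [Pi.smul_apply', poissonKernel_def, sub_zero, smul_eq_mul, mul_one, hz, hnorm,
      hsub z hz]
    field_simp
  have hmem : (r : ℂ) ^ 2 ∈ Metric.ball (0 : ℂ) r := by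
    rw [mem_ball_zero_iff, norm_pow, Complex.norm_of_nonneg hr0.le]
    nlinarith
  rw [Real.circleAverage_congr_sphere hkernel, Real.circleAverage_fun_smul,
    InnerProductSpace.HarmonicOnNhd.circleAverage_poissonKernel_smul
      (InnerProductSpace.harmonicOnNhd_const 1) hmem, smul_eq_mul, mul_one]

open Filter Topology in
lemma norm_coeff_le_circleAverage {E : Type*} [NormedAddCommGroup E] [NormedSpace ℂ E]
    [CompleteSpace E] {c : ℕ → E} {f : ℂ → E} {r : ℝ} (hr : 0 < r)
    (hf : DifferentiableOn ℂ f (Metric.closedBall 0 r))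
    (hc : ∀ᶠ z in 𝓝 (0 : ℂ), HasSum (fun n => z ^ n • c n) (f z)) (n : ℕ) :
    ‖c n‖ ≤ Real.circleAverage (fun z => ‖f z‖) 0 r * r⁻¹ ^ n := by
  let p : FormalMultilinearSeries ℂ ℂ E := fun n =>
    ContinuousMultilinearMap.mkPiRing ℂ (Fin n) (c n)
  have hp : HasFPowerSeriesAt f p 0 := by
    rw [hasFPowerSeriesAt_iff]
    simpa [p, FormalMultilinearSeries.coeff] using hc
  lift r to NNReal using hr.le
  have hcauchy := hf.hasFPowerSeriesOnBall (by exact_mod_cast hr)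
  have hle := norm_cauchyPowerSeries_le f 0 r n
  rwa [← hp.eq_formalMultilinearSeries hcauchy.hasFPowerSeriesAt,
    ContinuousMultilinearMap.norm_mkPiRing, NNReal.abs_eq] at hle

section RittCondition

variable {A : Type*} [NormedRing A] [NormedAlgebra ℂ A]

lemma HasRittResolvent.norm_one_sub_mul_inverse_le {a : A} {K : ℝ} (h : HasRittResolvent a K)
    {z : ℂ} (hz : ‖z‖ < 1) (hhalf : 1 / 2 ≤ ‖z‖) :
    ‖(1 - a) * Ring.inverse (1 - z • a)‖ ≤ 2 * (‖(1 : A)‖ + K) := by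
  obtain ⟨hunit, hK⟩ := h z hz
  have hresolvent : z • ((1 - a) * Ring.inverse (1 - z • a)) =
      1 - (1 - z) • Ring.inverse (1 - z • a) := by
    rw [eq_sub_iff_add_eq, ← smul_mul_assoc, ← smul_one_mul (1 - z), ← add_mul]
    convert Ring.mul_inverse_cancel _ hunit using 2
    module
  have hle : ‖z‖ * ‖(1 - a) * Ring.inverse (1 - z • a)‖ ≤ ‖(1 : A)‖ + K := by
    rw [← norm_smul, hresolvent]
    refine (norm_sub_le _ _).trans ?_
    rw [norm_smul, mul_comm]
    gcongr
    exact (le_div_iff₀ (norm_one_sub_pos_of_norm_lt_one hz)).1 hK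
  nlinarith [norm_nonneg ((1 - a) * Ring.inverse (1 - z • a))]

lemma HasRittResolvent.norm_one_sub_mul_inverse_pow_le {a : A} {K : ℝ}
    (h : HasRittResolvent a K) {z : ℂ} (hz : ‖z‖ < 1) (hhalf : 1 / 2 ≤ ‖z‖) :
    ‖(1 - a) * Ring.inverse (1 - z • a) ^ 3‖ ≤
      2 * (‖(1 : A)‖ + K) * K ^ 2 * (‖1 - z‖ ^ 2)⁻¹ := by
  have hK := h.nonneg
  calc ‖(1 - a) * Ring.inverse (1 - z • a) ^ 3‖
      = ‖(1 - a) * Ring.inverse (1 - z • a) * Ring.inverse (1 - z • a) ^ 2‖ := by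
        rw [mul_assoc, ← pow_succ']
    _ ≤ ‖(1 - a) * Ring.inverse (1 - z • a)‖ * ‖Ring.inverse (1 - z • a)‖ ^ 2 :=
        (norm_mul_le _ _).trans (by gcongr; exact norm_pow_le' _ two_pos)
    _ ≤ 2 * (‖(1 : A)‖ + K) * (K / ‖1 - z‖) ^ 2 := by
        gcongr
        · exact h.norm_one_sub_mul_inverse_le hz hhalf
        · exact (h z hz).2
    _ = 2 * (‖(1 : A)‖ + K) * K ^ 2 * (‖1 - z‖ ^ 2)⁻¹ := by
        rw [div_pow, div_eq_mul_inv, ← mul_assoc]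

variable [CompleteSpace A]

lemma HasRittResolvent.differentiableOn_one_sub_mul_inverse_pow {a : A} {K : ℝ}
    (h : HasRittResolvent a K) {r : ℝ} (hr : r < 1) :
    DifferentiableOn ℂ (fun z : ℂ => (1 - a) * Ring.inverse (1 - z • a) ^ 3)
      (Metric.closedBall 0 r) := by
  intro z hz
  have hz1 : ‖z‖ < 1 := (mem_closedBall_zero_iff.1 hz).trans_lt hr
  exact (((differentiableAt_inverse_one_sub_smul (h z hz1).1).pow 3).const_mul
    (1 - a)).differentiableWithinAt

lemma HasRittResolvent.circleAverage_norm_one_sub_mul_inverse_pow_le {a : A} {K : ℝ}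
    (h : HasRittResolvent a K) {r : ℝ} (hr : 1 / 2 ≤ r) (hr1 : r < 1) :
    Real.circleAverage (fun z : ℂ => ‖(1 - a) * Ring.inverse (1 - z • a) ^ 3‖) 0 r ≤
      2 * (‖(1 : A)‖ + K) * K ^ 2 / (1 - r) := by
  have hr0 : 0 < r := by linarith
  have hK := h.nonneg
  have hnorm_int : CircleIntegrable (fun z : ℂ => ‖(1 - a) * Ring.inverse (1 - z • a) ^ 3‖) 0 r :=
    ((h.differentiableOn_one_sub_mul_inverse_pow hr1).continuousOn.norm.mono
      Metric.sphere_subset_closedBall).circleIntegrable hr0.le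
  have hkernel_int : CircleIntegrable
      (fun z : ℂ => (2 * (‖(1 : A)‖ + K) * K ^ 2) • (‖1 - z‖ ^ 2)⁻¹) 0 r := by
    refine ContinuousOn.circleIntegrable hr0.le fun z hz => ContinuousAt.continuousWithinAt ?_
    have hz1 : ‖z‖ < 1 := by rwa [mem_sphere_zero_iff_norm.1 hz]
    have hne : ‖1 - z‖ ^ 2 ≠ 0 := (pow_pos (norm_one_sub_pos_of_norm_lt_one hz1) 2).ne'
    fun_prop (disch := exact hne)
  calc Real.circleAverage (fun z : ℂ => ‖(1 - a) * Ring.inverse (1 - z • a) ^ 3‖) 0 r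
      ≤ Real.circleAverage (fun z : ℂ => (2 * (‖(1 : A)‖ + K) * K ^ 2) • (‖1 - z‖ ^ 2)⁻¹) 0 r := by
        refine Real.circleAverage_mono hnorm_int hkernel_int fun z hz => ?_
        rw [mem_sphere_zero_iff_norm, abs_of_pos hr0] at hz
        exact h.norm_one_sub_mul_inverse_pow_le (hz ▸ hr1) (hz ▸ hr)
    _ = 2 * (‖(1 : A)‖ + K) * K ^ 2 * (1 - r ^ 2)⁻¹ := by
        rw [Real.circleAverage_fun_smul, circleAverage_inv_norm_one_sub_sq hr0 hr1, smul_eq_mul]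
    _ ≤ 2 * (‖(1 : A)‖ + K) * K ^ 2 / (1 - r) := by
        rw [← div_eq_mul_inv]
        gcongr
        nlinarith

open Filter Topology in
lemma eventually_hasSum_one_sub_mul_inverse_pow (a : A) :
    ∀ᶠ z in 𝓝 (0 : ℂ),
      HasSum (fun n : ℕ => z ^ n • ((n + 2).choose 2 : ℂ) • (a ^ n - a ^ (n + 1)))
        ((1 - a) * Ring.inverse (1 - z • a) ^ 3) := by
  have hsmall : ∀ᶠ z in 𝓝 (0 : ℂ), ‖z • a‖ < 1 := by
    have hcont : Continuous fun z : ℂ => ‖z • a‖ := by fun_prop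
    exact hcont.continuousAt.eventually_lt continuousAt_const (by simp)
  filter_upwards [hsmall] with z hz
  convert! (hasSum_choose_mul_geometric_of_norm_lt_one' 2 hz).mul_left (1 - a) using 2 with n
  rw [smul_pow, mul_smul_comm, mul_smul_comm, ← nsmul_eq_mul, mul_smul_comm, sub_mul, one_mul,
    ← pow_succ', Nat.cast_smul_eq_nsmul]

lemma inv_div_succ_pow_le {n : ℕ} (hn : 0 < n) : ((n : ℝ) / (n + 1))⁻¹ ^ n ≤ 3 := by
  have hn0 : (n : ℝ) ≠ 0 := by positivity
  calc ((n : ℝ) / (n + 1))⁻¹ ^ n = (1 / n + 1 : ℝ) ^ n := by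
        congr 1
        field_simp
        ring
    _ ≤ Real.exp (1 / n) ^ n := by
        gcongr
        exact Real.add_one_le_exp _
    _ = Real.exp 1 := by rw [← Real.exp_nat_mul, mul_one_div_cancel hn0]
    _ ≤ 3 := Real.exp_one_lt_three.le

/-- Cauchy's estimate on the circle of radius `n / (n + 1)`. -/
theorem HasRittResolvent.hasRittBound {a : A} {K : ℝ} (h : HasRittResolvent a K) :
    HasRittBound a (12 * ((‖(1 : A)‖ + K) * K ^ 2)) := by
  intro n hn
  have hK := h.nonneg
  have hn1 : (1 : ℝ) ≤ n := by exact_mod_cast hn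
  have hr1 : (n : ℝ) / (n + 1) < 1 := by rw [div_lt_one (by positivity)]; linarith
  have hhalf : 1 / 2 ≤ (n : ℝ) / (n + 1) := by
    rw [div_le_div_iff₀ two_pos (by positivity)]
    linarith
  have hr : 2 * (‖(1 : A)‖ + K) * K ^ 2 / (1 - n / (n + 1)) =
      2 * (‖(1 : A)‖ + K) * K ^ 2 * (n + 1) := by
    field_simp
    ring
  have hcauchy : ‖((n + 2).choose 2 : ℂ) • (a ^ n - a ^ (n + 1))‖ ≤
      2 * (‖(1 : A)‖ + K) * K ^ 2 / (1 - n / (n + 1)) * 3 :=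
    (norm_coeff_le_circleAverage (by linarith) (h.differentiableOn_one_sub_mul_inverse_pow hr1)
      (eventually_hasSum_one_sub_mul_inverse_pow a) n).trans <|
    mul_le_mul (h.circleAverage_norm_one_sub_mul_inverse_pow_le hhalf hr1)
      (inv_div_succ_pow_le hn) (by positivity) (div_nonneg (by positivity) (sub_nonneg.2 hr1.le))
  rw [norm_smul, Complex.norm_natCast, Nat.cast_choose_two, hr] at hcauchy
  push_cast at hcauchy
  refine le_of_mul_le_mul_left (a := (n : ℝ) + 1) ?_ (by positivity)
  nlinarith [norm_nonneg (a ^ n - a ^ (n + 1))]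

end RittCondition

section Transfer

variable {R S 𝓕 : Type*} [NormedRing R] [NormedRing S] [FunLike 𝓕 R S] [RingHomClass 𝓕 R S]
  {φ : 𝓕} {a : R} {C M : ℝ}

lemma IsPowerBounded.map (ha : IsPowerBounded a) (hM : 0 ≤ M) (hφ : ∀ x, ‖φ x‖ ≤ M * ‖x‖) :
    IsPowerBounded (φ a) := by
  obtain ⟨C, hC⟩ := ha
  refine ⟨M * C, fun n hn => ?_⟩
  rw [← map_pow]
  exact (hφ _).trans (mul_le_mul_of_nonneg_left (hC n hn) hM)

lemma HasRittBound.map (ha : HasRittBound a C) (hM : 0 ≤ M) (hφ : ∀ x, ‖φ x‖ ≤ M * ‖x‖) :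
    HasRittBound (φ a) (M * C) := by
  intro n hn
  rw [← map_pow, ← map_pow, ← map_sub]
  calc n * ‖φ (a ^ n - a ^ (n + 1))‖
      ≤ n * (M * ‖a ^ n - a ^ (n + 1)‖) := by gcongr; exact hφ _
    _ = M * (n * ‖a ^ n - a ^ (n + 1)‖) := by ring
    _ ≤ M * C := mul_le_mul_of_nonneg_left (ha n hn) hM

lemma isPowerBounded_map_iff (hφ : ∀ x, ‖φ x‖ = ‖x‖) :
    IsPowerBounded (φ a) ↔ IsPowerBounded a := by
  simp only [IsPowerBounded, ← map_pow, hφ]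

lemma hasRittBound_map_iff (hφ : ∀ x, ‖φ x‖ = ‖x‖) :
    HasRittBound (φ a) C ↔ HasRittBound a C := by
  simp only [HasRittBound, ← map_pow, ← map_sub, hφ]

end Transfer

section Scalar

variable {l : ℂ} {C : ℝ}

lemma mem_discOne_of_hasRittBound (hl : ‖l‖ ≤ 1) (hC : HasRittBound l C) : l ∈ discOne := by
  rcases hl.lt_or_eq with h | h
  · exact Or.inl (mem_ball_zero_iff.2 h)
  · refine Or.inr ?_
    by_contra hne
    have hpos : 0 < ‖1 - l‖ := norm_pos_iff.2 (sub_ne_zero.2 (Ne.symm hne))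
    obtain ⟨n, hn⟩ := exists_nat_gt (C / ‖1 - l‖)
    rw [div_lt_iff₀ hpos] at hn
    have hstep : ‖l ^ (n + 1) - l ^ (n + 1 + 1)‖ = ‖1 - l‖ := by
      rw [pow_succ l (n + 1), ← mul_one_sub, norm_mul, norm_pow, h, one_pow, one_mul]
    have hle := hC (n + 1) (Nat.le_add_left 1 n)
    rw [hstep, Nat.cast_add_one] at hle
    linarith

/-- For `0 < Re z` the bound is the one at time `t = 1 / Re z`. -/
lemma HasAnalyticBound.norm_le {z : ℂ} (h : HasAnalyticBound z C) (hz : 0 ≤ z.re) :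
    ‖z‖ ≤ C * Real.exp 1 * z.re := by
  have hexp : ∀ t : ℝ, 0 ≤ t → t * (‖z‖ * Real.exp (-(t * z.re))) ≤ C := fun t ht => by
    have ht' := h t ht
    rwa [← Complex.exp_eq_exp_ℂ, norm_mul, Complex.norm_exp, smul_eq_mul, ← Complex.ofReal_neg,
      Complex.re_ofReal_mul, neg_mul] at ht'
  rcases hz.eq_or_lt with h0 | hpos
  · rw [← h0, mul_zero]
    by_contra! hz0
    have hlarge := hexp ((C + 1) / ‖z‖) (div_nonneg (by linarith [h.nonneg]) hz0.le)
    rw [← h0, mul_zero, neg_zero, Real.exp_zero, mul_one, div_mul_cancel₀ _ hz0.ne'] at hlarge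
    linarith
  · have hinv := hexp z.re⁻¹ (inv_nonneg.2 hz)
    rw [inv_mul_cancel₀ hpos.ne', Real.exp_neg, inv_mul_le_iff₀ hpos,
      ← div_eq_mul_inv, div_le_iff₀ (Real.exp_pos 1)] at hinv
    linarith

lemma HasRittBound.norm_one_sub_le (hl : ‖l‖ ≤ 1) (hC : HasRittBound l C) :
    ‖1 - l‖ ≤ (2 * C + 2) * Real.exp 1 * (1 - l).re := by
  have hre : 0 ≤ (1 - l).re := by
    rw [Complex.sub_re, Complex.one_re, sub_nonneg]
    exact (Complex.re_le_norm l).trans hl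
  have hnorm : ‖1 - l‖ ≤ 2 := (norm_sub_le _ _).trans (by rw [norm_one]; linarith)
  refine (hC.hasAnalyticBound.norm_le hre).trans ?_
  gcongr

lemma mem_closedSector_of_norm_le {z : ℂ} {K : ℝ} (hK : 0 < K) (hz : ‖z‖ ≤ K * z.re) :
    z ∈ closedSector (Real.arccos K⁻¹) := by
  rcases eq_or_ne z 0 with rfl | h0
  · exact Or.inl rfl
  refine Or.inr ?_
  have hcos : K⁻¹ ≤ Real.cos |z.arg| := by
    rw [Real.cos_abs, Complex.cos_arg h0, inv_eq_one_div,
      div_le_div_iff₀ hK (norm_pos_iff.2 h0), one_mul, mul_comm]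
    exact hz
  have harccos := Real.arccos_le_arccos hcos
  rwa [Real.arccos_cos (abs_nonneg _) (Complex.abs_arg_le_pi z)] at harccos

end Scalar

namespace L1Z

lemma norm_single (i : ℤ) : ‖(lp.single 1 i (1 : ℂ) : L1Z)‖ = 1 := by
  rw [lp.norm_single zero_lt_one, norm_one]

instance : NormOneClass L1Z := ⟨norm_single 0⟩

end L1Z

/-- The Banach algebra `L¹(ℤ⁺)`, as the closed subalgebra of the functions in `L¹(ℤ)` that vanish
on the negative integers. -/
def L1ZPlus : Subalgebra ℂ L1Z where
  carrier := {F | ∀ k : ℤ, k < 0 → F k = 0}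
  mul_mem' {F G} hF hG m hm := by
    rw [L1Z.mul_apply]
    convert! tsum_zero with k
    rcases lt_or_ge k 0 with hk | hk
    · rw [hF k hk, zero_mul]
    · rw [hG (m - k) (by lia), mul_zero]
  add_mem' {F G} hF hG k hk := by
    rw [lp.coeFn_add, Pi.add_apply, hF k hk, hG k hk, add_zero]
  algebraMap_mem' c k hk := by
    rw [Algebra.algebraMap_eq_smul_one, lp.coeFn_smul, Pi.smul_apply, L1Z.one_apply,
      if_neg hk.ne, smul_zero]

namespace L1ZPlus

lemma support_subset_range_natCast {F : L1Z} (hF : F ∈ L1ZPlus) {E : Type*} [Zero E] {f : ℤ → E}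
    (hf : ∀ k, F k = 0 → f k = 0) : Function.support f ⊆ Set.range ((↑) : ℕ → ℤ) := by
  intro k hk
  rcases lt_or_ge k 0 with h | h
  · exact absurd (hf k (hF k h)) hk
  · exact ⟨k.toNat, Int.toNat_of_nonneg h⟩

lemma tsum_natCast {F : L1Z} (hF : F ∈ L1ZPlus) {E : Type*} [AddCommMonoid E]
    [TopologicalSpace E] {f : ℤ → E} (hf : ∀ k, F k = 0 → f k = 0) :
    ∑' k : ℕ, f k = ∑' k : ℤ, f k :=
  Nat.cast_injective.tsum_eq (support_subset_range_natCast hF hf)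

lemma summable_norm (F : L1Z) : Summable fun k : ℕ => ‖F k‖ :=
  F.summable_norm.comp_injective Nat.cast_injective

lemma mul_apply_natCast {F G : L1Z} (hF : F ∈ L1ZPlus) (hG : G ∈ L1ZPlus) (m : ℕ) :
    (F * G) m = ∑ k ∈ Finset.range (m + 1), F k * G (m - k : ℕ) := by
  rw [L1Z.mul_apply, ← tsum_natCast hF fun k hk => by rw [hk, zero_mul],
    tsum_eq_sum (s := Finset.range (m + 1)) fun k hk => ?_]
  · refine Finset.sum_congr rfl fun k hk => ?_
    rw [Nat.cast_sub (Finset.mem_range_succ_iff.1 hk)]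
  · rw [Finset.mem_range] at hk
    rw [hG _ (by lia), mul_zero]

end L1ZPlus

section FunctionalCalculus

variable {B : Type*} [NormedRing B] [NormedAlgebra ℂ B] {b : B} {M : ℝ}

lemma norm_apply_smul_pow_le (F : L1Z) (hb : ∀ k : ℕ, ‖b ^ k‖ ≤ M) (k : ℕ) :
    ‖F k • b ^ k‖ ≤ ‖F k‖ * M := by
  rw [norm_smul]
  exact mul_le_mul_of_nonneg_left (hb k) (norm_nonneg _)

lemma summable_norm_apply_smul_pow (F : L1Z) (hb : ∀ k : ℕ, ‖b ^ k‖ ≤ M) :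
    Summable fun k : ℕ => ‖F k • b ^ k‖ :=
  .of_nonneg_of_le (fun _ => norm_nonneg _) (norm_apply_smul_pow_le F hb)
    ((L1ZPlus.summable_norm F).mul_right M)

/-- The functional calculus `F ↦ ∑_{k ≥ 0} F(k) b ^ k` of an element `b` with bounded powers. It
specializes to `F ↦ Ψ(F; T)` and to `F ↦ φ_F(w)`. -/
def powSeriesHom [CompleteSpace B] (hb : ∀ k : ℕ, ‖b ^ k‖ ≤ M) : L1ZPlus →ₐ[ℂ] B :=
  AlgHom.ofLinearMap
    { toFun := fun F => ∑' k : ℕ, (F : L1Z) k • b ^ k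
      map_add' := fun F G => by
        rw [← (summable_norm_apply_smul_pow F hb).of_norm.tsum_add
          (summable_norm_apply_smul_pow G hb).of_norm]
        exact tsum_congr fun k => add_smul _ _ _
      map_smul' := fun c F => by
        rw [RingHom.id_apply, ← (summable_norm_apply_smul_pow F hb).of_norm.tsum_const_smul]
        exact tsum_congr fun k => mul_smul _ _ _ }
    (by
      refine (tsum_eq_single 0 fun k hk => ?_).trans ?_
      · rw [OneMemClass.coe_one, L1Z.one_apply, if_neg (Nat.cast_ne_zero.2 hk), zero_smul]
      · rw [OneMemClass.coe_one, L1Z.one_apply, if_pos Nat.cast_zero, one_smul, pow_zero])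
    (fun F G => by
      refine .trans ?_ (tsum_mul_tsum_eq_tsum_sum_range_of_summable_norm
        (summable_norm_apply_smul_pow F hb) (summable_norm_apply_smul_pow G hb)).symm
      refine tsum_congr fun m => ?_
      rw [MulMemClass.coe_mul, L1ZPlus.mul_apply_natCast F.2 G.2, Finset.sum_smul]
      refine Finset.sum_congr rfl fun k hk => ?_
      rw [smul_mul_smul_comm, ← pow_add, Nat.add_sub_cancel' (Finset.mem_range_succ_iff.1 hk)])

lemma norm_powSeriesHom_le [CompleteSpace B] (hb : ∀ k : ℕ, ‖b ^ k‖ ≤ M) (F : L1ZPlus) :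
    ‖powSeriesHom hb F‖ ≤ M * ‖F‖ := by
  have hsum : ∑' k : ℕ, ‖(F : L1Z) k‖ = ‖F‖ := by
    rw [L1ZPlus.tsum_natCast F.2 (f := fun k => ‖(F : L1Z) k‖) fun k hk => by rw [hk, norm_zero]]
    exact (F : L1Z).norm_eq.symm
  rw [mul_comm, ← hsum]
  exact tsum_of_norm_bounded ((L1ZPlus.summable_norm F).hasSum.mul_right M)
    (norm_apply_smul_pow_le F hb)

lemma HasRittBound.tsum_smul_pow [CompleteSpace B] {F : L1Z} {C : ℝ} (h : HasRittBound F C)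
    (hF : F ∈ L1ZPlus) (hb : ∀ k : ℕ, ‖b ^ k‖ ≤ M) :
    HasRittBound (∑' k : ℕ, F k • b ^ k) (M * C) := by
  have hF' : HasRittBound (⟨F, hF⟩ : L1ZPlus) C :=
    (hasRittBound_map_iff (φ := L1ZPlus.val) fun _ => rfl).1 h
  exact hF'.map ((norm_nonneg _).trans (hb 0)) (norm_powSeriesHom_le hb)

lemma IsPowerBounded.tsum_smul_pow [CompleteSpace B] {F : L1Z} (h : IsPowerBounded F)
    (hF : F ∈ L1ZPlus) (hb : ∀ k : ℕ, ‖b ^ k‖ ≤ M) :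
    IsPowerBounded (∑' k : ℕ, F k • b ^ k) := by
  have hF' : IsPowerBounded (⟨F, hF⟩ : L1ZPlus) :=
    (isPowerBounded_map_iff (φ := L1ZPlus.val) fun _ => rfl).1 h
  exact hF'.map ((norm_nonneg _).trans (hb 0)) (norm_powSeriesHom_le hb)

end FunctionalCalculus

/-- The left regular representation `a ↦ (x ↦ a * x)`, as a homomorphism of unital algebras. -/
def leftMulHom (A : Type*) [NormedRing A] [NormedAlgebra ℂ A] : A →ₐ[ℂ] A →L[ℂ] A :=
  AlgHom.ofLinearMap (ContinuousLinearMap.mul ℂ A : A →ₗ[ℂ] A →L[ℂ] A)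
    (ContinuousLinearMap.ext one_mul)
    (fun a b => ContinuousLinearMap.ext (mul_assoc a b))

lemma norm_leftMulHom {A : Type*} [NormedRing A] [NormedAlgebra ℂ A] [NormOneClass A] (a : A) :
    ‖leftMulHom A a‖ = ‖a‖ :=
  ContinuousLinearMap.opNorm_mul_apply ℂ A a

namespace L1Z

lemma single_mul_single (i j : ℤ) :
    (lp.single 1 i (1 : ℂ) : L1Z) * lp.single 1 j (1 : ℂ) = lp.single 1 (i + j) (1 : ℂ) := by
  ext m
  rw [mul_apply, tsum_eq_single i]
  · simp only [lp.single_apply, Pi.single_apply, if_true, one_mul, sub_eq_iff_eq_add']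
  · intro k hk
    rw [lp.single_apply_ne _ _ _ hk, zero_mul]

/-- The point mass `δ₁`, which generates the Banach algebra `L¹(ℤ⁺)`. -/
def delta : L1Z := lp.single 1 (1 : ℤ) (1 : ℂ)

lemma delta_pow (n : ℕ) : delta ^ n = (lp.single 1 (n : ℤ) (1 : ℂ) : L1Z) := by
  induction n with
  | zero => rfl
  | succ n ih => rw [pow_succ, ih, delta, single_mul_single, Nat.cast_add_one]

lemma isPowerBounded_delta : IsPowerBounded delta :=
  ⟨1, fun n _ => by rw [delta_pow, norm_single]⟩

end L1Z

lemma L1ZPlus.hasSum_smul_delta_pow {F : L1Z} (hF : F ∈ L1ZPlus) :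
    HasSum (fun k : ℕ => F k • L1Z.delta ^ k) F := by
  have hterm : ∀ k : ℤ, F k • (lp.single 1 k (1 : ℂ) : L1Z) = lp.single 1 k (F k) := fun k => by
    rw [← lp.single_smul, smul_eq_mul, mul_one]
  have hsum : HasSum (fun k : ℤ => F k • (lp.single 1 k (1 : ℂ) : L1Z)) F := by
    simpa only [hterm] using lp.hasSum_single ENNReal.one_ne_top F
  simp only [L1Z.delta_pow]
  exact (Nat.cast_injective.hasSum_iff <| Function.support_subset_iff'.1 <|
    support_subset_range_natCast hF fun k hk => by rw [hk, zero_smul]).2 hsum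

lemma L1ZPlus.map_eq_tsum {B : Type*} [NormedRing B] [NormedAlgebra ℂ B] {F : L1Z}
    (hF : F ∈ L1ZPlus) {φ : L1Z →ₐ[ℂ] B} (hφ : Continuous φ) :
    φ F = ∑' k : ℕ, F k • φ L1Z.delta ^ k := by
  have h := (hasSum_smul_delta_pow hF).map φ hφ
  simpa only [Function.comp_def, map_smul, map_pow] using h.tsum_eq.symm

lemma norm_pow_le_one_of_norm_le_one {R : Type*} [NormedRing R] [NormOneClass R] {a : R}
    (ha : ‖a‖ ≤ 1) (n : ℕ) : ‖a ^ n‖ ≤ 1 :=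
  (norm_pow_le a n).trans (pow_le_one₀ (norm_nonneg a) ha)

lemma norm_cexp_I_mul_ofReal_le_one (t : ℝ) : ‖Complex.exp (Complex.I * t)‖ ≤ 1 :=
  (Complex.norm_exp_I_mul_ofReal t).le

section Probability

variable {F : L1Z}

lemma mem_L1ZPlus_of_mem_probZPlus (hF : F ∈ probZPlus) : F ∈ L1ZPlus := fun _ hk =>
  by_contra fun h => absurd (hF.2.2 h) (not_le.2 hk)

lemma ofReal_norm_apply_of_mem_probZPlus (hF : F ∈ probZPlus) (k : ℤ) :
    ((‖F k‖ : ℝ) : ℂ) = F k :=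
  Complex.norm_of_nonneg' (hF.1 k)

lemma norm_of_mem_probZPlus (hF : F ∈ probZPlus) : ‖F‖ = 1 := by
  rw [← Complex.ofReal_inj, F.norm_eq, Complex.ofReal_tsum, Complex.ofReal_one, ← hF.2.1]
  exact tsum_congr (ofReal_norm_apply_of_mem_probZPlus hF)

lemma isPowerBounded_of_mem_probZPlus (hF : F ∈ probZPlus) : IsPowerBounded F :=
  ⟨1, fun n _ => norm_pow_le_one_of_norm_le_one (norm_of_mem_probZPlus hF).le n⟩

lemma norm_genFun_le_one (hF : F ∈ probZPlus) {w : ℂ} (hw : ‖w‖ ≤ 1) : ‖genFun F w‖ ≤ 1 := by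
  have h := norm_powSeriesHom_le (norm_pow_le_one_of_norm_le_one hw)
    ⟨F, mem_L1ZPlus_of_mem_probZPlus hF⟩
  exact h.trans_eq ((one_mul _).trans (norm_of_mem_probZPlus hF))

lemma HasRittBound.genFun {C : ℝ} (hC : HasRittBound F C) (hF : F ∈ probZPlus) {w : ℂ}
    (hw : ‖w‖ ≤ 1) : HasRittBound (genFun F w) C := by
  rw [← one_mul C]
  exact hC.tsum_smul_pow (mem_L1ZPlus_of_mem_probZPlus hF) (norm_pow_le_one_of_norm_le_one hw)

lemma genFun_mem_discOne (hF : F ∈ classA) {w : ℂ} (hw : ‖w‖ ≤ 1) : genFun F w ∈ discOne := by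
  obtain ⟨hprob, C, hC : HasRittBound F C⟩ := hF
  exact mem_discOne_of_hasRittBound (norm_genFun_le_one hprob hw) (hC.genFun hprob hw)

lemma exists_norm_one_sub_genFun_le (hF : F ∈ classA) :
    ∃ K : ℝ, 1 < K ∧ ∀ w : ℂ, ‖w‖ ≤ 1 → ‖1 - genFun F w‖ ≤ K * (1 - genFun F w).re := by
  obtain ⟨hprob, C, hC : HasRittBound F C⟩ := hF
  refine ⟨(2 * C + 2) * Real.exp 1, ?_, fun w hw =>
    (hC.genFun hprob hw).norm_one_sub_le (norm_genFun_le_one hprob hw)⟩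
  nlinarith [hC.nonneg, Real.add_one_lt_exp one_ne_zero]

lemma exists_sector (hF : F ∈ classA) :
    ∃ θ : ℝ, 0 < θ ∧ θ < Real.pi / 2 ∧
      ∀ w : ℂ, ‖w‖ ≤ 1 → genFun F w ∈ discOne ∧ 1 - genFun F w ∈ closedSector θ := by
  obtain ⟨K, hK1, hK⟩ := exists_norm_one_sub_genFun_le hF
  have hK0 : 0 < K := zero_lt_one.trans hK1
  exact ⟨Real.arccos K⁻¹, Real.arccos_pos.2 (inv_lt_one_of_one_lt₀ hK1),
    Real.arccos_lt_pi_div_two.2 (inv_pos.2 hK0), fun w hw =>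
      ⟨genFun_mem_discOne hF hw, mem_closedSector_of_norm_le hK0 (hK w hw)⟩⟩

end Probability

section Operators

variable {F : L1Z}

lemma mem_classA_iff_isRitt_convOp (hF : F ∈ probZPlus) : F ∈ classA ↔ IsRitt (convOp F) := by
  have hiso : ∀ G : L1Z, ‖leftMulHom L1Z G‖ = ‖G‖ := norm_leftMulHom
  have hpow : IsPowerBounded (leftMulHom L1Z F) :=
    (isPowerBounded_map_iff hiso).2 (isPowerBounded_of_mem_probZPlus hF)
  have hRitt : (∃ C, HasRittBound (leftMulHom L1Z F) C) ↔ ∃ C, HasRittBound F C :=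
    exists_congr fun _ => hasRittBound_map_iff hiso
  exact (and_congr (iff_of_true hF hpow) hRitt.symm :)

lemma isRitt_Psi (hF : F ∈ classA) {X : Type*} [NormedAddCommGroup X] [NormedSpace ℂ X]
    [CompleteSpace X] {T : X →L[ℂ] X} (hT : IsPowerBounded T) : IsRitt (Psi F T) := by
  obtain ⟨hprob, C, hC : HasRittBound F C⟩ := hF
  obtain ⟨M, hM⟩ := hT.exists_forall_norm_pow_le
  have hplus := mem_L1ZPlus_of_mem_probZPlus hprob
  exact ⟨(isPowerBounded_of_mem_probZPlus hprob).tsum_smul_pow hplus hM,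
    M * C, hC.tsum_smul_pow hplus hM⟩

lemma Psi_map_delta (hF : F ∈ L1ZPlus) {X : Type*} [NormedAddCommGroup X] [NormedSpace ℂ X]
    {φ : L1Z →ₐ[ℂ] X →L[ℂ] X} (hφ : Continuous φ) : Psi F (φ L1Z.delta) = φ F :=
  (L1ZPlus.map_eq_tsum hF hφ).symm

lemma mem_classA_of_isRitt_Psi_of_isometric {A : Type*} [NormedRing A] [NormedAlgebra ℂ A]
    [NormOneClass A] (hF : F ∈ probZPlus) (ψ : L1Z →ₐ[ℂ] A) (hψ : ∀ G, ‖ψ G‖ = ‖G‖)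
    (h : ∀ T : A →L[ℂ] A, IsPowerBounded T → IsRitt (Psi F T)) : F ∈ classA := by
  let φ : L1Z →ₐ[ℂ] A →L[ℂ] A := (leftMulHom A).comp ψ
  have hφ : ∀ G : L1Z, ‖φ G‖ = ‖G‖ := fun G => (norm_leftMulHom (ψ G)).trans (hψ G)
  obtain ⟨-, C, hC⟩ := h (φ L1Z.delta) ((isPowerBounded_map_iff hφ).2 L1Z.isPowerBounded_delta)
  rw [Psi_map_delta (mem_L1ZPlus_of_mem_probZPlus hF)
    (AddMonoidHomClass.isometry_of_norm φ hφ).continuous] at hC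
  exact ⟨hF, C, (hasRittBound_map_iff hφ).1 hC⟩

universe u

/-- Convolution by `δ₁` on a copy of `L¹(ℤ)` in the given universe is already a test operator. -/
lemma mem_classA_of_forall_isRitt_Psi (hF : F ∈ probZPlus)
    (h : ∀ (X : Type u) [NormedAddCommGroup X] [NormedSpace ℂ X] [CompleteSpace X]
      (T : X →L[ℂ] X), IsPowerBounded T → IsRitt (Psi F T)) : F ∈ classA :=
  mem_classA_of_isRitt_Psi_of_isometric hF
    (ULift.algEquiv.symm : L1Z ≃ₐ[ℂ] ULift.{u} L1Z).toAlgHom ULift.norm_up (h _)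

end Operators

section Spectrum

variable {F : L1Z}

lemma exists_norm_eq_one_forall_character_eq_genFun (χ : WeakDual.characterSpace ℂ L1Z) :
    ∃ w : ℂ, ‖w‖ = 1 ∧ ∀ F ∈ L1ZPlus, χ F = genFun F w := by
  have hle : ∀ i : ℤ, ‖χ (lp.single 1 i (1 : ℂ) : L1Z)‖ ≤ 1 := fun i =>
    (AlgHom.norm_apply_le_self χ _).trans_eq (L1Z.norm_single i)
  refine ⟨χ L1Z.delta, (hle 1).antisymm ?_, fun F hF => ?_⟩
  · have hinv : χ L1Z.delta * χ (lp.single 1 (-1 : ℤ) (1 : ℂ) : L1Z) = 1 := by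
      rw [← map_mul, L1Z.delta, L1Z.single_mul_single, add_neg_cancel]
      exact map_one χ
    calc (1 : ℝ) = ‖χ L1Z.delta‖ * ‖χ (lp.single 1 (-1 : ℤ) (1 : ℂ) : L1Z)‖ := by
          rw [← norm_mul, hinv, norm_one]
      _ ≤ ‖χ L1Z.delta‖ := mul_le_of_le_one_right (norm_nonneg _) (hle (-1))
  · exact L1ZPlus.map_eq_tsum hF (φ := WeakDual.CharacterSpace.toAlgHom χ) (map_continuous χ)

lemma fourierZ_eq_genFun (hF : F ∈ L1ZPlus) (ξ : ℝ) :
    fourierZ F ξ = genFun F (Complex.exp (Complex.I * (-ξ : ℝ))) := by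
  rw [fourierZ, genFun, ← L1ZPlus.tsum_natCast hF fun k hk => by rw [hk, zero_mul]]
  refine tsum_congr fun k => ?_
  rw [← Complex.exp_nat_mul]
  congr 2
  push_cast
  ring

lemma exists_angle_of_norm_eq_one {w : ℂ} (hw : ‖w‖ = 1) :
    ∃ ξ ∈ Set.Icc (-Real.pi) Real.pi, Complex.exp (Complex.I * (-ξ : ℝ)) = w := by
  refine ⟨-w.arg, ⟨neg_le_neg (Complex.arg_le_pi w), ?_⟩, ?_⟩
  · exact neg_le.1 (Complex.neg_pi_lt_arg w).le
  · rw [neg_neg, mul_comm]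
    simpa only [hw, Complex.ofReal_one, one_mul] using Complex.norm_mul_exp_arg_mul_I w

lemma isUnit_one_sub_smul_of_fourierZ_mem_discOne (hF : F ∈ L1ZPlus)
    (h : ∀ ξ ∈ Set.Icc (-Real.pi) Real.pi, fourierZ F ξ ∈ discOne) {z : ℂ} (hz : ‖z‖ = 1)
    (hz1 : z ≠ 1) : IsUnit (1 - z • F) := by
  by_contra hu
  obtain ⟨χ, hχ⟩ := WeakDual.CharacterSpace.exists_apply_eq_zero hu
  obtain ⟨w, hw, hχw⟩ := exists_norm_eq_one_forall_character_eq_genFun χ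
  obtain ⟨ξ, hξ, rfl⟩ := exists_angle_of_norm_eq_one hw
  rw [map_sub, map_one, map_smul, hχw F hF, ← fourierZ_eq_genFun hF, smul_eq_mul,
    sub_eq_zero] at hχ
  rcases h ξ hξ with hlt | heq
  · have hnorm : 1 = ‖fourierZ F ξ‖ := by
      rw [← one_mul ‖fourierZ F ξ‖, ← hz, ← norm_mul, ← hχ, hz, norm_one]
    exact absurd (mem_ball_zero_iff.1 hlt) hnorm.not_gt
  · rw [Set.mem_singleton_iff.1 heq, mul_one] at hχ
    exact hz1 hχ.symm

lemma mem_classA_iff_fourierZ_mem_discOne_and_exp (hF : F ∈ probZPlus) :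
    F ∈ classA ↔ (∀ ξ ∈ Set.Icc (-Real.pi) Real.pi, fourierZ F ξ ∈ discOne) ∧
      ∃ C : ℝ, ∀ t : ℝ, 1 ≤ t →
        t * ‖(1 - F) * NormedSpace.exp (-(t : ℂ) • (1 - F))‖ ≤ C := by
  have hplus := mem_L1ZPlus_of_mem_probZPlus hF
  constructor
  · intro hA
    refine ⟨fun ξ _ => ?_, ?_⟩
    · rw [fourierZ_eq_genFun hplus]
      exact genFun_mem_discOne hA (norm_cexp_I_mul_ofReal_le_one _)
    · obtain ⟨-, C, hC : HasRittBound F C⟩ := hA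
      exact ⟨_, fun t ht => hC.hasAnalyticBound t (zero_le_one.trans ht)⟩
  · rintro ⟨hξ, C, hC⟩
    obtain ⟨C', hC'⟩ := exists_hasAnalyticBound_of_one_le hC
    obtain ⟨K, hK⟩ := exists_hasRittResolvent (isPowerBounded_of_mem_probZPlus hF)
      (fun _ => isUnit_one_sub_smul_of_fourierZ_mem_discOne hplus hξ) hC'
    exact ⟨hF, _, hK.hasRittBound⟩

end Spectrum

section FirstMoment

/-- A differentiable curve through `0` that stays in a sector around the positive axis has its
real part minimal at `0`, so the real part, and with it the whole curve, is stationary there. -/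
lemma eq_zero_of_hasDerivAt_of_norm_le {f : ℝ → ℂ} {d : ℂ} {K x : ℝ} (hd : HasDerivAt f d x)
    (hx : f x = 0) (hf : ∀ t, ‖f t‖ ≤ K * (f t).re) : d = 0 := by
  set g : ℝ → ℝ := fun t => K * (f t).re
  have hgx : g x = 0 := by simp only [g, hx, Complex.zero_re, mul_zero]
  have hg : HasDerivAt g (K * d.re) x :=
    (Complex.reCLM.hasFDerivAt.comp_hasDerivAt x hd).const_mul K
  have hmin : IsLocalMin g x := .of_forall fun t => hgx.trans_le ((norm_nonneg _).trans (hf t))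
  rw [hmin.hasDerivAt_eq_zero hg, hasDerivAt_iff_isLittleO] at hg
  refine hd.unique (hasDerivAt_iff_isLittleO.2 ?_)
  simp only [hx, hgx, smul_zero, sub_zero] at hg ⊢
  exact (Asymptotics.IsBigO.of_norm_le fun t => hf t).trans_isLittleO hg

variable {F : L1Z}

lemma hasDerivAt_genFun_cexp (hm : Summable fun k : ℕ => k * ‖F k‖) :
    HasDerivAt (fun t : ℝ => genFun F (Complex.exp (Complex.I * t)))
      (Complex.I * ∑' k : ℕ, k * F k) 0 := by
  have hterm : ∀ (k : ℕ) (t : ℝ), HasDerivAt (fun t : ℝ => F k * Complex.exp (Complex.I * t) ^ k)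
      (Complex.I * (k * F k) * Complex.exp (Complex.I * t) ^ k) t := fun k t => by
    have hcexp : HasDerivAt (fun z : ℂ => F k * Complex.exp (k * (Complex.I * z)))
        (F k * (Complex.exp (k * (Complex.I * t)) * (k * (Complex.I * 1)))) t :=
      ((((hasDerivAt_id' _).const_mul Complex.I).const_mul (k : ℂ)).cexp).const_mul (F k)
    simp only [← Complex.exp_nat_mul]
    exact hcexp.comp_ofReal.congr_deriv (by ring)
  have hbound : ∀ (k : ℕ) (t : ℝ),
      ‖Complex.I * (k * F k) * Complex.exp (Complex.I * t) ^ k‖ ≤ k * ‖F k‖ := fun k t => by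
    rw [norm_mul, norm_mul, Complex.norm_I, one_mul, norm_mul, Complex.norm_natCast]
    exact mul_le_of_le_one_right (by positivity)
      (norm_pow_le_one_of_norm_le_one (norm_cexp_I_mul_ofReal_le_one t) k)
  have hsummable : Summable fun k : ℕ => F k * Complex.exp (Complex.I * (0 : ℝ)) ^ k :=
    (summable_norm_apply_smul_pow F
      (norm_pow_le_one_of_norm_le_one (norm_cexp_I_mul_ofReal_le_one 0))).of_norm
  refine (hasDerivAt_tsum hm hterm hbound hsummable 0).congr_deriv ?_
  simp only [Complex.ofReal_zero, mul_zero, Complex.exp_zero, one_pow, mul_one, tsum_mul_left]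

lemma genFun_one (hF : F ∈ probZPlus) : genFun F 1 = 1 := by
  simp only [genFun, one_pow, mul_one]
  rw [L1ZPlus.tsum_natCast (mem_L1ZPlus_of_mem_probZPlus hF) fun _ h => h, hF.2.1]

lemma eq_one_of_forall_natCast_ne_zero (hF : F ∈ probZPlus)
    (h : ∀ k : ℕ, k ≠ 0 → F k = 0) : F = 1 := by
  have hzero : ∀ k : ℤ, k ≠ 0 → F k = 0 := fun k hk => by
    rcases lt_or_ge k 0 with hneg | hnonneg
    · exact mem_L1ZPlus_of_mem_probZPlus hF k hneg
    · lift k to ℕ using hnonneg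
      exact h k (Nat.cast_ne_zero.1 hk)
  ext k
  rw [L1Z.one_apply]
  split_ifs with hk
  · rw [hk, ← hF.2.1, tsum_eq_single 0 hzero]
  · exact hzero k hk

lemma eq_one_of_summable_moment (hF : F ∈ classA) (hm : Summable fun k : ℕ => k * ‖F k‖) :
    F = 1 := by
  obtain ⟨K, -, hK⟩ := exists_norm_one_sub_genFun_le hF
  have hone : 1 - genFun F (Complex.exp (Complex.I * (0 : ℝ))) = 0 := by
    rw [Complex.ofReal_zero, mul_zero, Complex.exp_zero, genFun_one hF.1, sub_self]
  have hderiv : Complex.I * ∑' k : ℕ, k * F k = 0 :=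
    neg_eq_zero.1 <| eq_zero_of_hasDerivAt_of_norm_le ((hasDerivAt_genFun_cexp hm).const_sub 1)
      hone fun t => hK _ (norm_cexp_I_mul_ofReal_le_one t)
  have hmoment : ∑' k : ℕ, k * ‖F k‖ = 0 := by
    rw [← Complex.ofReal_eq_zero, Complex.ofReal_tsum,
      ← (mul_eq_zero.1 hderiv).resolve_left Complex.I_ne_zero]
    refine tsum_congr fun k => ?_
    rw [Complex.ofReal_mul, Complex.ofReal_natCast, ofReal_norm_apply_of_mem_probZPlus hF.1]
  refine eq_one_of_forall_natCast_ne_zero hF.1 fun k hk => ?_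
  have hterm : k * ‖F k‖ = 0 :=
    congrFun ((hasSum_zero_iff_of_nonneg fun k => by positivity).1 (hmoment ▸ hm.hasSum)) k
  exact norm_eq_zero.1 ((mul_eq_zero.1 hterm).resolve_left (Nat.cast_ne_zero.2 hk))

lemma tsum_moment_eq_top (hF : F ∈ classA) (hne : F ≠ 1) :
    ∑' k : ℕ, (k : ℝ≥0∞) * ENNReal.ofReal (F k).re = ⊤ := by
  by_contra h
  refine hne (eq_one_of_summable_moment hF ((ENNReal.summable_toReal h).congr fun k => ?_))
  have hre : (F k).re = ‖F k‖ := by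
    rw [← Complex.ofReal_re ‖F k‖, ofReal_norm_apply_of_mem_probZPlus hF.1]
  rw [ENNReal.toReal_mul, ENNReal.toReal_natCast, hre, ENNReal.toReal_ofReal (norm_nonneg _)]

lemma infinite_support (hF : F ∈ classA) (hne : F ≠ 1) :
    (Function.support (F : ℤ → ℂ)).Infinite := fun hfin => by
  refine hne (eq_one_of_summable_moment hF (summable_of_hasFiniteSupport ?_))
  refine (hfin.preimage Nat.cast_injective.injOn).subset fun k hk => ?_
  exact norm_ne_zero_iff.1 (right_ne_zero_of_mul hk)

end FirstMoment

end RittProb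

end

theorem theorem4p1 (F : RittProb.L1Z) (hF : F ∈ RittProb.probZPlus) :
    List.TFAE
      [ F ∈ RittProb.classA,
        RittProb.IsRitt (RittProb.convOp F),
        ∀ (X : Type*) [NormedAddCommGroup X] [NormedSpace ℂ X] [CompleteSpace X]
          (T : X →L[ℂ] X),
          RittProb.IsPowerBounded T → RittProb.IsRitt (RittProb.Psi F T),
        (∀ ξ ∈ Set.Icc (-Real.pi) Real.pi, RittProb.fourierZ F ξ ∈ RittProb.discOne) ∧
          ∃ C : ℝ, ∀ t : ℝ, 1 ≤ t →
            t * ‖(1 - F) * NormedSpace.exp (-(t : ℂ) • (1 - F))‖ ≤ C ] ∧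
    (F ∈ RittProb.classA →
      ∃ θ : ℝ, 0 < θ ∧ θ < Real.pi / 2 ∧
        ∀ w : ℂ, ‖w‖ ≤ 1 →
          RittProb.genFun F w ∈ RittProb.discOne ∧
          1 - RittProb.genFun F w ∈ RittProb.closedSector θ) ∧
    (F ∈ RittProb.classA → F ≠ 1 →
      ∑' k : ℕ, (k : ℝ≥0∞) * ENNReal.ofReal (F (k : ℤ)).re = ⊤ ∧
      (Function.support (F : ℤ → ℂ)).Infinite) := by
  refine ⟨?_, RittProb.exists_sector, fun hA hne =>
    ⟨RittProb.tsum_moment_eq_top hA hne, RittProb.infinite_support hA hne⟩⟩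
  tfae_have 1 ↔ 2 := RittProb.mem_classA_iff_isRitt_convOp hF
  tfae_have 1 → 3 := fun hA _ _ _ _ _ hT => RittProb.isRitt_Psi hA hT
  tfae_have 3 → 1 := RittProb.mem_classA_of_forall_isRitt_Psi hF
  tfae_have 1 ↔ 4 := RittProb.mem_classA_iff_fourierZ_mem_discOne_and_exp hF
  tfae_finish
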